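/- Let $P$ be a finite set (of qubits), let $V=\mathbb F_2\oplus\mathbb F_2$ with standard basis $(z,x)$ and symplectic form $\omega$, and equip $V^P$ with the sum of these forms. Let $L\subset V^P$ be an isotropic subspace (that is, $\omega|_{L\times L}=0$). For $S\subset P$ let $V^S\subset V^P$ be the space of vectors vanishing outside $S$ and put $L_S=L\cap V^S$; we say that $L$ splits off $L_S$ if $L=L_S\times L_{P\setminus S}$. A zero factor is a split-off $L_S=0$ with $S\neq\emptyset$; a Bell Lagrangian is a split-off $L_S$ with $|S|=2$ that is Lagrangian in $V^S$ (isotropic of dimension $|S|$) and indecomposable (not of the form $L_T\times L_{S\setminus T}$ with $\emptyset\ne T\subsetneq S$). Let the Pauli group be the group of operators on $(\mathbb C^2)^{\otimes P}$ formed by the products of a scalar of absolute value one and a tensor product of Pauli operators, with its projection to $V^P$ ($Z\mapsto z$, $X\mapsto x$), and let $\sigma$ be a homomorphic section of this projection over $L$. Let $C(L,\sigma)=\{\psi\in(\mathbb C^2)^{\otimes P}\mid\sigma(v)\psi=\psi\text{ for all }v\in L\}$ be the stabilizer code, and let $$A(L,\sigma)=\Bigl\{g\in SO(3)^P\ \Big|\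 \bigl(\textstyle\bigotimes_{p}\tilde g_p\bigr)C(L,\sigma)\subset C(L,\sigma)\text{ for some }\tilde g\in U(2)^P\text{ representing }g\Bigr\}$$ be its automorphism group, where $U(2)/S^1=SO(3)$ via the adjoint action on traceless Hermitian operators (with basis $X,Y,Z$). If $L$ splits off no zero factor and no Bell Lagrangian then, for every such $\sigma$, the group $A(L,\sigma)$, with the topology induced from $SO(3)^P$, is a solvable compact Lie group. Moreover $A(L,\sigma)$ is a closed subgroup of $SO(3)^P$ contained in a product $\prod_{p\in P}G_p$ in which each $G_p\subset SO(3)$ is either the octahedral group generated by the rotations by a right angle around the three coordinate axes, or one of the three infinite dihedral groups $D_a$, $a\in\{x,y,z\}$, generated by all rotations around the $a$ axis and one rotation by 180 degrees around an orthogonal coordinate axis. -/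

import Mathlib

open scoped Matrix Manifold ContDiff

noncomputable section

namespace Stabilizer

/-! ### The symplectic side -/

/-- The binary plane `V = 𝔽₂ ⊕ 𝔽₂`, with standard basis `z = (1, 0)`, `x = (0, 1)`. -/
abbrev V : Type := ZMod 2 × ZMod 2

/-- The symplectic form on `V ^ P`: the sum over the qubits of the symplectic form of `V`. -/
def omega {P : Type*} [Fintype P] (v w : P → V) : ZMod 2 :=
  ∑ p, ((v p).1 * (w p).2 - (v p).2 * (w p).1)

/-- A subspace is isotropic if the symplectic form vanishes identically on it. -/
def IsIsotropic {P : Type*} [Fintype P] (L : Submodule (ZMod 2) (P → V)) : Prop :=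
  ∀ v ∈ L, ∀ w ∈ L, omega v w = 0

/-- The subspace `V ^ S` of `V ^ P`: the vectors supported in `S`. -/
def supportedIn {P : Type*} (S : Set P) : Submodule (ZMod 2) (P → V) where
  carrier := {v | ∀ p, p ∉ S → v p = 0}
  add_mem' := fun ha hb p hp => by simp [ha p hp, hb p hp]
  zero_mem' := fun _ _ => rfl
  smul_mem' := fun c v hv p hp => by simp [hv p hp]

/-- `L_S = L ∩ V ^ S`. -/
def part {P : Type*} (L : Submodule (ZMod 2) (P → V)) (S : Set P) :
    Submodule (ZMod 2) (P → V) :=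
  L ⊓ supportedIn S

/-- `L` is the direct product of `L_S` and `L_{P ∖ S}`, so `L_S` is a direct factor of `L`.
(The sum is automatically direct, as the supports are disjoint.) -/
def SplitsOff {P : Type*} (L : Submodule (ZMod 2) (P → V)) (S : Set P) : Prop :=
  L = part L S ⊔ part L Sᶜ

/-- `L_S`, as a subspace of `V ^ S`, is not a direct product `L_T × L_{S ∖ T}` with
`∅ ≠ T ≠ S`. -/
def IsIndecomposable {P : Type*} (L : Submodule (ZMod 2) (P → V)) (S : Set P) : Prop :=
  ∀ T : Set P, T ⊆ S → T.Nonempty → T ≠ S → part L S ≠ part L T ⊔ part L (S \ T)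

/-- `L_S`, as a subspace of `V ^ S`, is Lagrangian: isotropic of dimension `|S|`. -/
def IsLagrangianOn {P : Type*} [Fintype P] (L : Submodule (ZMod 2) (P → V)) (S : Set P) :
    Prop :=
  IsIsotropic (part L S) ∧ Module.finrank (ZMod 2) (part L S) = S.ncard

/-- `L` has a direct factor that is zero, over a non-empty set of qubits. -/
def HasZeroFactor {P : Type*} (L : Submodule (ZMod 2) (P → V)) : Prop :=
  ∃ S : Set P, S.Nonempty ∧ SplitsOff L S ∧ part L S = ⊥

/-- `L` has a direct factor that is an indecomposable Lagrangian over two qubits. -/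
def HasBellFactor {P : Type*} [Fintype P] (L : Submodule (ZMod 2) (P → V)) : Prop :=
  ∃ S : Set P, S.ncard = 2 ∧ SplitsOff L S ∧ IsLagrangianOn L S ∧ IsIndecomposable L S

/-! ### Local operators and Pauli operators -/

/-- Operators on `ℋ^{⊗P}`, `ℋ = ℂ²`, as matrices in the computational basis, which is indexed by
the bit strings `P → Fin 2`. A state is its amplitude function `(P → Fin 2) → ℂ`. -/
abbrev Op (P : Type*) : Type _ := Matrix (P → Fin 2) (P → Fin 2) ℂ

/-- The tensor product `⨂ₚ Aₚ` of one-qubit operators. -/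
def tensorOp {P : Type*} [Fintype P] (A : P → Matrix (Fin 2) (Fin 2) ℂ) : Op P :=
  Matrix.of fun i j => ∏ p, A p (i p) (j p)

/-- `tensorOp` acts on product states factor by factor. -/
theorem tensorOp_mulVec {P : Type*} [Fintype P] [DecidableEq P]
    (A : P → Matrix (Fin 2) (Fin 2) ℂ) (φ : P → Fin 2 → ℂ) :
    tensorOp A *ᵥ (fun i => ∏ p, φ p (i p)) = fun i => ∏ p, (A p *ᵥ φ p) (i p) := by
  ext i
  simp only [Matrix.mulVec, dotProduct, tensorOp, Matrix.of_apply, ← Finset.prod_mul_distrib]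
  rw [Fintype.prod_sum (fun p a => A p (i p) a * φ p a)]

theorem tensorOp_mul {P : Type*} [Fintype P] [DecidableEq P]
    (A B : P → Matrix (Fin 2) (Fin 2) ℂ) :
    tensorOp A * tensorOp B = tensorOp fun p => A p * B p := by
  ext i k
  simp only [Matrix.mul_apply, tensorOp, Matrix.of_apply, ← Finset.prod_mul_distrib]
  rw [Fintype.prod_sum (fun p a => A p (i p) a * B p a (k p))]

theorem tensorOp_one {P : Type*} [Fintype P] [DecidableEq P] :
    tensorOp (fun _ : P => 1) = 1 := by
  ext i j
  simp only [tensorOp, Matrix.of_apply, Matrix.one_apply, Finset.prod_ite_zero, Finset.prod_const_one,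
    Finset.mem_univ, true_implies, funext_iff]

/-- The Pauli matrices `X`, `Y`, `Z`, in this order. -/
def pauli : Fin 3 → Matrix (Fin 2) (Fin 2) ℂ :=
  ![!![0, 1; 1, 0], !![0, -Complex.I; Complex.I, 0], !![1, 0; 0, -1]]

/-- A Pauli operator representing `v ∈ V`: `z ↦ Z`, `x ↦ X`, and `z + x ↦ Z X = i Y`. -/
def pauliOp (v : V) : Matrix (Fin 2) (Fin 2) ℂ :=
  pauli 2 ^ v.1.val * pauli 0 ^ v.2.val

/-- `U` is an element of the Pauli group (the tensor products of Pauli operators times arbitrary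
scalars of absolute value one) that projects to `v ∈ V ^ P`. -/
def IsPauliOver {P : Type*} [Fintype P] (v : P → V) (U : Op P) : Prop :=
  ∃ c : ℂ, ‖c‖ = 1 ∧ U = c • tensorOp fun p => pauliOp (v p)

/-- A homomorphic section over `L` of the projection from the Pauli group to `V ^ P`. -/
structure PauliSection {P : Type*} [Fintype P] [DecidableEq P]
    (L : Submodule (ZMod 2) (P → V)) where
  toHom : Multiplicative L →* Op P
  isPauliOver : ∀ v : L, IsPauliOver (v : P → V) (toHom (Multiplicative.ofAdd v))

/-- The stabilizer code `C(L, σ)`: the common fixed space of all `σ(v)`, `v ∈ L`. -/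
def code {P : Type*} [Fintype P] [DecidableEq P] {L : Submodule (ZMod 2) (P → V)}
    (σ : PauliSection L) : Submodule ℂ ((P → Fin 2) → ℂ) where
  carrier := {ψ | ∀ v : L, σ.toHom (Multiplicative.ofAdd v) *ᵥ ψ = ψ}
  add_mem' := fun ha hb v => by rw [Matrix.mulVec_add, ha v, hb v]
  zero_mem' := fun v => Matrix.mulVec_zero _
  smul_mem' := fun c ψ hψ v => by rw [Matrix.mulVec_smul, hψ v]

/-! ### The automorphism group -/

abbrev U2 : Type := Matrix.unitaryGroup (Fin 2) ℂ

abbrev SO3 : Type := Matrix.specialOrthogonalGroup (Fin 3) ℝ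

/-- `u ∈ U(2)` represents `g ∈ SO(3)`: the matrix of the adjoint action of `u` on the traceless
Hermitian operators, with respect to their basis `X, Y, Z`, is `g`. -/
def Represents (u : U2) (g : SO3) : Prop :=
  ∀ j, (u : Matrix (Fin 2) (Fin 2) ℂ) * pauli j * (u : Matrix (Fin 2) (Fin 2) ℂ)ᴴ =
    ∑ i, (((g : Matrix (Fin 3) (Fin 3) ℝ) i j : ℝ) : ℂ) • pauli i

theorem Represents.one : Represents 1 1 := by
  intro j
  simp [Matrix.one_apply]

theorem Represents.mul {u u' : U2} {g g' : SO3} (h : Represents u g) (h' : Represents u' g') :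
    Represents (u * u') (g * g') := by
  intro j
  have e : ((u * u' : U2) : Matrix (Fin 2) (Fin 2) ℂ) * pauli j *
      ((u * u' : U2) : Matrix (Fin 2) (Fin 2) ℂ)ᴴ =
      (u : Matrix (Fin 2) (Fin 2) ℂ) * ((u' : Matrix (Fin 2) (Fin 2) ℂ) * pauli j *
        (u' : Matrix (Fin 2) (Fin 2) ℂ)ᴴ) * (u : Matrix (Fin 2) (Fin 2) ℂ)ᴴ := by
    simp only [Submonoid.coe_mul, Matrix.conjTranspose_mul, Matrix.mul_assoc]
  rw [e, h' j]
  simp only [Matrix.mul_sum, Matrix.sum_mul, Matrix.mul_smul, Matrix.smul_mul]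
  simp only [h _, Finset.smul_sum, Submonoid.coe_mul, Matrix.mul_apply, smul_smul]
  rw [Finset.sum_comm]
  refine Finset.sum_congr rfl fun k _ => ?_
  rw [← Finset.sum_smul]
  push_cast
  simp only [mul_comm]

theorem Represents.inv {u : U2} {g : SO3} (h : Represents u g) : Represents u⁻¹ g⁻¹ := by
  intro j
  have hu : (u : Matrix (Fin 2) (Fin 2) ℂ)ᴴ * (u : Matrix (Fin 2) (Fin 2) ℂ) = 1 :=
    Matrix.UnitaryGroup.star_mul_self u
  have hi : ((u⁻¹ : U2) : Matrix (Fin 2) (Fin 2) ℂ) = (u : Matrix (Fin 2) (Fin 2) ℂ)ᴴ := rfl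
  have hg : (g : Matrix (Fin 3) (Fin 3) ℝ) * ((g⁻¹ : SO3) : Matrix (Fin 3) (Fin 3) ℝ) = 1 := by
    rw [← Submonoid.coe_mul, mul_inv_cancel, Submonoid.coe_one]
  set M : Matrix (Fin 2) (Fin 2) ℂ :=
    ∑ i, ((((g⁻¹ : SO3) : Matrix (Fin 3) (Fin 3) ℝ) i j : ℝ) : ℂ) • pauli i with hM
  have key : pauli j = (u : Matrix (Fin 2) (Fin 2) ℂ) * M * (u : Matrix (Fin 2) (Fin 2) ℂ)ᴴ := by
    simp only [hM, Matrix.mul_sum, Matrix.sum_mul, Matrix.mul_smul, Matrix.smul_mul, h _,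
      Finset.smul_sum, smul_smul]
    rw [Finset.sum_comm]
    simp only [← Finset.sum_smul]
    have hk : ∀ k, ∑ i, (((((g⁻¹ : SO3) : Matrix (Fin 3) (Fin 3) ℝ) i j : ℝ) : ℂ) *
        (((g : Matrix (Fin 3) (Fin 3) ℝ) k i : ℝ) : ℂ)) = if k = j then 1 else 0 := by
      intro k
      have := congrFun (congrFun hg k) j
      rw [Matrix.mul_apply, Matrix.one_apply] at this
      have h2 := congrArg (fun r : ℝ => (r : ℂ)) this
      simp only [Complex.ofReal_sum, Complex.ofReal_mul] at h2
      refine (Finset.sum_congr rfl fun i _ => mul_comm _ _).trans (h2.trans ?_)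
      split_ifs <;> simp
    simp only [hk]
    simp
  rw [hi, Matrix.conjTranspose_conjTranspose, key]
  calc _ = ((u : Matrix (Fin 2) (Fin 2) ℂ)ᴴ * (u : Matrix (Fin 2) (Fin 2) ℂ)) * M *
        ((u : Matrix (Fin 2) (Fin 2) ℂ)ᴴ * (u : Matrix (Fin 2) (Fin 2) ℂ)) := by
        simp only [Matrix.mul_assoc]
    _ = M := by rw [hu]; simp

/-- The automorphism group `A(L, σ)`: all `g ∈ SO(3) ^ P` such that some family of unitaries
representing `g` sends the code into itself. -/
def autGroup {P : Type*} [Fintype P] [DecidableEq P] {L : Submodule (ZMod 2) (P → V)}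
    (σ : PauliSection L) : Subgroup (P → SO3) where
  carrier := {g | ∃ u : P → U2, (∀ p, Represents (u p) (g p)) ∧
    ∀ ψ ∈ code σ, tensorOp (fun p => (u p : Matrix (Fin 2) (Fin 2) ℂ)) *ᵥ ψ ∈ code σ}
  one_mem' := ⟨1, fun _ => Represents.one, fun ψ hψ => by
    simpa [tensorOp_one] using hψ⟩
  mul_mem' := by
    rintro g g' ⟨u, hu, hc⟩ ⟨u', hu', hc'⟩
    refine ⟨u * u', fun p => (hu p).mul (hu' p), fun ψ hψ => ?_⟩
    have := hc _ (hc' ψ hψ)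
    rw [Matrix.mulVec_mulVec, tensorOp_mul] at this
    simpa using this
  inv_mem' := by
    rintro g ⟨u, hu, hc⟩
    refine ⟨u⁻¹, fun p => (hu p).inv, fun ψ hψ => ?_⟩
    have hinv : tensorOp (fun p => ((u⁻¹ : P → U2) p : Matrix (Fin 2) (Fin 2) ℂ)) *
        tensorOp (fun p => (u p : Matrix (Fin 2) (Fin 2) ℂ)) = 1 := by
      rw [tensorOp_mul, ← tensorOp_one]
      congr 1
      funext p
      rw [Pi.inv_apply, ← Submonoid.coe_mul, inv_mul_cancel, Submonoid.coe_one]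
    let f : code σ →ₗ[ℂ] code σ :=
      (Matrix.mulVecLin (tensorOp (fun p => (u p : Matrix (Fin 2) (Fin 2) ℂ)))).restrict hc
    have hf : Function.Injective f := by
      intro a b hab
      have h0 : tensorOp (fun p => (u p : Matrix (Fin 2) (Fin 2) ℂ)) *ᵥ (a : (P → Fin 2) → ℂ) =
          tensorOp (fun p => (u p : Matrix (Fin 2) (Fin 2) ℂ)) *ᵥ (b : (P → Fin 2) → ℂ) :=
        congrArg Subtype.val hab
      have h1 := congrArg (fun c =>
        tensorOp (fun p => ((u⁻¹ : P → U2) p : Matrix (Fin 2) (Fin 2) ℂ)) *ᵥ c) h0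
      simp only [Matrix.mulVec_mulVec, hinv, Matrix.one_mulVec] at h1
      exact Subtype.ext h1
    obtain ⟨φ, hφ⟩ := (LinearMap.injective_iff_surjective.mp hf) ⟨ψ, hψ⟩
    have h2 : tensorOp (fun p => (u p : Matrix (Fin 2) (Fin 2) ℂ)) *ᵥ (φ : (P → Fin 2) → ℂ) = ψ :=
      congrArg Subtype.val hφ
    rw [← h2, Matrix.mulVec_mulVec, hinv, Matrix.one_mulVec]
    exact φ.2

/-! ### Octahedral and dihedral subgroups of `SO(3)` -/

/-- The matrix of the rotation by the angle `θ` around the `x`, `y`, `z` axis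
(`a = 0, 1, 2` respectively). -/
def axisRotMatrix (a : Fin 3) (θ : ℝ) : Matrix (Fin 3) (Fin 3) ℝ :=
  ![!![1, 0, 0; 0, Real.cos θ, -Real.sin θ; 0, Real.sin θ, Real.cos θ],
    !![Real.cos θ, 0, Real.sin θ; 0, 1, 0; -Real.sin θ, 0, Real.cos θ],
    !![Real.cos θ, -Real.sin θ, 0; Real.sin θ, Real.cos θ, 0; 0, 0, 1]] a

theorem axisRotMatrix_mem (a : Fin 3) (θ : ℝ) :
    axisRotMatrix a θ ∈ Matrix.specialOrthogonalGroup (Fin 3) ℝ := by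
  have h := Real.sin_sq_add_cos_sq θ
  rw [Matrix.mem_specialOrthogonalGroup_iff, Matrix.mem_orthogonalGroup_iff]
  constructor
  · ext i j
    fin_cases a <;> fin_cases i <;> fin_cases j <;>
      simp [axisRotMatrix, Matrix.mul_apply, Fin.sum_univ_three] <;> nlinarith [h]
  · fin_cases a <;> simp [axisRotMatrix, Matrix.det_fin_three] <;> nlinarith [h]

/-- The rotation by the angle `θ` around the axis `a`. -/
def axisRot (a : Fin 3) (θ : ℝ) : SO3 := ⟨axisRotMatrix a θ, axisRotMatrix_mem a θ⟩

/-- The octahedral group, generated by the rotations by a right angle around the three axes. -/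
def octahedral : Subgroup SO3 :=
  Subgroup.closure (Set.range fun a : Fin 3 => axisRot a (Real.pi / 2))

/-- The infinite dihedral group `D_a`, generated by all rotations around the axis `a` and one
rotation by `180` degrees around an orthogonal axis. -/
def dihedral (a : Fin 3) : Subgroup SO3 :=
  Subgroup.closure ((Set.range fun θ : ℝ => axisRot a θ) ∪ {axisRot (a + 1) Real.pi})

end Stabilizer

/-- The topological group `G`, with its given topology, is a compact real (smooth,
finite-dimensional) Lie group. -/
def IsCompactLieGroup (G : Type*) [Group G] [TopologicalSpace G] : Prop :=
  CompactSpace G ∧ T2Space G ∧ ∃ (n : ℕ) (_ : ChartedSpace (EuclideanSpace ℝ (Fin n)) G),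
    LieGroup (𝓡 n) ∞ G

end

open Stabilizer

open scoped Matrix Manifold ContDiff

noncomputable section

namespace Stabilizer

/-! Up to a scalar, the projector to the code is the sum of all `σ(v)`, so its Pauli expansion has
non-zero coefficients exactly at the elements of `L`. An automorphism commutes with it
(`conj_sumOp`). Hence conjugating the projector by `g` at one qubit `p` only, or by `g⁻¹` at all
other qubits, gives the same operator, and a Pauli coefficient with a single contribution on one
side must have a contribution on the other (`exists_coeff_of_mem_autGroup`).

Let `S` be minimal among the supports of vectors of `L` that contain `p`. Local conjugation
preserves supports of Pauli operators, so the comparison takes place inside `L_S`. If the vectors of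
`L_S` take only one non-zero value at `p`, then `g p` preserves the corresponding axis. Otherwise
`L_S` maps onto `V` at `p`, minimality makes every non-zero vector of `L_S` have full support `S`,
and isotropy together with the absence of a Bell factor gives `S` at least three elements. A
coefficient that mixes two vectors of `L_S` at two further qubits then shows that `g p` has one
non-zero entry per row: it is a signed permutation of the axes. This is `autGroup_local`.

Axis stabilizers are dihedral, integral rotations are octahedral, and both are solvable. The
automorphism group is closed because it is the projection of a compact set of pairs `(u, g)`. Near
the identity, the local constraint makes it a subgroup of a torus of rotations around fixed axes.
Its preimage in the space of angles is a closed subgroup of a Euclidean space and agrees with a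
linear subspace near zero. This subspace supplies a chart at the identity; conjugation acts linearly
on it, so the translated charts form a Lie group atlas. -/

/-! ### Subgroups of `SO(3)` defined by conditions on the matrix entries -/

/-- The matrix entries of an element of `SO(3)`. -/
def SO3.entry (g : SO3) (i j : Fin 3) : ℝ := (g : Matrix (Fin 3) (Fin 3) ℝ) i j

namespace SO3

theorem ext_entry {g h : SO3} (H : ∀ i j, g.entry i j = h.entry i j) : g = h :=
  Subtype.ext (Matrix.ext H)

theorem entry_mul (g h : SO3) (i j : Fin 3) :
    (g * h).entry i j = ∑ k, g.entry i k * h.entry k j := by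
  simp [entry, Matrix.mul_apply]

theorem entry_one (i j : Fin 3) : (1 : SO3).entry i j = if i = j then 1 else 0 := by
  simp [entry, Matrix.one_apply]

theorem entry_inv (g : SO3) (i j : Fin 3) : g⁻¹.entry i j = g.entry j i := rfl

theorem det_entry (g : SO3) : (g : Matrix (Fin 3) (Fin 3) ℝ).det = 1 :=
  (Matrix.mem_specialOrthogonalGroup_iff.1 g.2).2

theorem row_inner (g : SO3) (i j : Fin 3) :
    ∑ k, g.entry i k * g.entry j k = if i = j then 1 else 0 := by
  rw [← entry_one, ← mul_inv_cancel g, entry_mul]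
  simp only [entry_inv]

theorem col_inner (g : SO3) (i j : Fin 3) :
    ∑ k, g.entry k i * g.entry k j = if i = j then 1 else 0 := by
  rw [← entry_one, ← inv_mul_cancel g, entry_mul]
  simp only [entry_inv]

/-- A row of an element of `SO(3)` with an entry of square one is zero elsewhere. -/
theorem row_eq_zero {g : SO3} {i j k : Fin 3} (h : g.entry i j ^ 2 = 1) (hk : k ≠ j) :
    g.entry i k = 0 := by
  have h1 := g.row_inner i i
  have h2 := Finset.sum_le_sum_of_subset_of_nonneg (Finset.subset_univ {j, k})
    fun l _ _ => mul_self_nonneg (g.entry i l)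
  rw [h1, if_pos rfl, Finset.sum_pair hk.symm] at h2
  nlinarith [sq_nonneg (g.entry i k)]

theorem col_eq_zero {g : SO3} {i j k : Fin 3} (h : g.entry j i ^ 2 = 1) (hk : k ≠ j) :
    g.entry k i = 0 := by
  rw [← entry_inv] at h ⊢
  exact row_eq_zero h hk

end SO3

/-- The subgroup of `SO(3)` of the matrices with integral entries. -/
def integralSO3 : Subgroup SO3 where
  carrier := {g | ∀ i j, ∃ n : ℤ, g.entry i j = n}
  one_mem' := fun i j => ⟨if i = j then 1 else 0, by rw [SO3.entry_one]; split_ifs <;> simp⟩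
  mul_mem' := by
    intro g h hg hh i j
    choose a ha using hg
    choose b hb using hh
    exact ⟨∑ k, a i k * b k j, by simp [SO3.entry_mul, ha, hb]⟩
  inv_mem' := fun hg i j => by simpa only [SO3.entry_inv] using hg j i

theorem entry_self_mul {a : Fin 3} {g : SO3} (hg : g.entry a a ^ 2 = 1) (h : SO3) :
    (g * h).entry a a = g.entry a a * h.entry a a := by
  rw [SO3.entry_mul]
  exact Finset.sum_eq_single a (fun k _ hk => by rw [SO3.row_eq_zero hg hk, zero_mul])
    (by simp)

/-- The subgroup of `SO(3)` of the rotations that preserve the coordinate axis `a`. -/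
def axisStabilizer (a : Fin 3) : Subgroup SO3 where
  carrier := {g | g.entry a a ^ 2 = 1}
  one_mem' := by simp [SO3.entry_one]
  mul_mem' := by
    intro g h hg hh
    change (g * h).entry a a ^ 2 = 1
    rw [entry_self_mul hg, mul_pow, show g.entry a a ^ 2 = 1 from hg,
      show h.entry a a ^ 2 = 1 from hh, one_mul]
  inv_mem' := fun hg => hg

theorem mem_axisStabilizer_iff {a : Fin 3} {g : SO3} :
    g ∈ axisStabilizer a ↔ g.entry a a ^ 2 = 1 := Iff.rfl

theorem mem_axisStabilizer_of_col {a : Fin 3} {g : SO3} (h : ∀ b, b ≠ a → g.entry b a = 0) :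
    g ∈ axisStabilizer a := by
  have := g.col_inner a a
  rw [Finset.sum_eq_single a (fun b _ hb => by rw [h b hb, zero_mul]) (by simp)] at this
  rw [mem_axisStabilizer_iff, sq, this, if_pos rfl]

/-- An integral orthogonal matrix has entries `0`, `1`, `-1`. -/
theorem entry_of_mem_integralSO3 {g : SO3} (hg : g ∈ integralSO3) (i j : Fin 3) :
    g.entry i j = 0 ∨ g.entry i j = 1 ∨ g.entry i j = -1 := by
  obtain ⟨n, hn⟩ := hg i j
  have h1 : g.entry i j ^ 2 ≤ 1 := by
    have := g.row_inner i i
    rw [if_pos rfl] at this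
    rw [← this, sq]
    exact Finset.single_le_sum (f := fun k => g.entry i k * g.entry i k)
      (fun k _ => mul_self_nonneg _) (Finset.mem_univ j)
  rw [hn] at h1 ⊢
  have h2 : n ^ 2 ≤ 1 := by exact_mod_cast h1
  have h3 : n ≤ 1 := by nlinarith
  have h4 : -1 ≤ n := by nlinarith
  interval_cases n <;> simp

/-- A rotation with at most one non-zero entry in each row is integral. -/
theorem mem_integralSO3_of_row {g : SO3}
    (h : ∀ i j k, j ≠ k → g.entry i j * g.entry i k = 0) : g ∈ integralSO3 := by
  intro i j
  by_cases h0 : g.entry i j = 0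
  · exact ⟨0, by simp [h0]⟩
  have := g.row_inner i i
  rw [Finset.sum_eq_single j _ (by simp), if_pos rfl, mul_self_eq_one_iff] at this
  · rcases this with h | h
    · exact ⟨1, by simp [h]⟩
    · exact ⟨-1, by simp [h]⟩
  · intro k _ hk
    rcases mul_eq_zero.1 (h i j k hk.symm) with h | h
    · exact absurd h h0
    · rw [h, zero_mul]

theorem exists_entry_ne_zero (g : SO3) (j : Fin 3) : ∃ i, g.entry i j ≠ 0 := by
  by_contra! h
  have := g.col_inner j j
  simp [h] at this

theorem exists_sq_entry_eq_one {g : SO3} (hg : g ∈ integralSO3) (j : Fin 3) :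
    ∃ i, g.entry i j ^ 2 = 1 := by
  obtain ⟨i, hi⟩ := exists_entry_ne_zero g j
  refine ⟨i, ?_⟩
  rcases entry_of_mem_integralSO3 hg i j with h | h | h
  · exact absurd h hi
  all_goals rw [h]; norm_num

/-! #### Integral rotations are octahedral -/

theorem entry_axisRot (a : Fin 3) (θ : ℝ) (i j : Fin 3) :
    (axisRot a θ).entry i j = axisRotMatrix a θ i j := rfl

theorem axisRot_mem_octahedral (a : Fin 3) : axisRot a (Real.pi / 2) ∈ octahedral :=
  Subgroup.subset_closure ⟨a, rfl⟩

theorem axisRot_mem_integralSO3 (a : Fin 3) : axisRot a (Real.pi / 2) ∈ integralSO3 := by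
  refine mem_integralSO3_of_row fun i j k hjk => ?_
  fin_cases a <;> fin_cases i <;> fin_cases j <;> fin_cases k <;>
    simp [SO3.entry, axisRot, axisRotMatrix] at hjk ⊢

theorem octahedral_le_integralSO3 : octahedral ≤ integralSO3 := by
  rw [octahedral, Subgroup.closure_le]
  rintro _ ⟨a, rfl⟩
  exact axisRot_mem_integralSO3 a

/-- Every off-diagonal position shares a row or column with one of the two given entries, so it
vanishes; the determinant then fixes the last diagonal entry. -/
theorem SO3.eq_one_of_diag {g : SO3} (a : Fin 3) (h0 : g.entry a a = 1)
    (h1 : g.entry (a + 1) (a + 1) = 1) : g = 1 := by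
  have s0 : g.entry a a ^ 2 = 1 := by rw [h0]; norm_num
  have s1 : g.entry (a + 1) (a + 1) ^ 2 = 1 := by rw [h1]; norm_num
  have off : ∀ i j, i ≠ j → g.entry i j = 0 := by
    intro i j hij
    have : i = a ∨ i = a + 1 ∨ j = a ∨ j = a + 1 := by
      clear s0 s1 h0 h1; decide +revert
    rcases this with rfl | rfl | rfl | rfl
    · exact SO3.row_eq_zero s0 hij.symm
    · exact SO3.row_eq_zero s1 hij.symm
    · exact SO3.col_eq_zero s0 hij
    · exact SO3.col_eq_zero s1 hij
  have d := g.det_entry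
  rw [Matrix.det_fin_three] at d
  simp only [← SO3.entry.eq_1] at d
  have r01 : g.entry 0 1 = 0 := off _ _ (by decide)
  have r02 : g.entry 0 2 = 0 := off _ _ (by decide)
  have r12 : g.entry 1 2 = 0 := off _ _ (by decide)
  simp only [r01, r02, r12] at d
  refine SO3.ext_entry fun i j => ?_
  rw [SO3.entry_one]
  split_ifs with hij
  · subst hij
    fin_cases a <;>
      simp only [Fin.zero_eta, Fin.mk_one, Fin.reduceFinMk, Fin.reduceAdd] at h0 h1 <;>
      simp only [h0, h1] at d <;> fin_cases i <;> simp <;> linarith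
  · exact off i j hij

/-- Column `1` has its entry `±1` in row `1` or `2`. A power of the right-angle rotation around the
first axis moves it to `+1` on the diagonal, and `SO3.eq_one_of_diag` finishes. -/
theorem mem_octahedral_of_entry_zero_zero {g : SO3} (hg : g ∈ integralSO3)
    (h : g.entry 0 0 = 1) : g ∈ octahedral := by
  have s0 : g.entry 0 0 ^ 2 = 1 := by rw [h]; norm_num
  have r01 : g.entry 0 1 = 0 := SO3.row_eq_zero s0 (by decide)
  have key : ∀ k ∈ octahedral, (k * g).entry 0 0 = 1 → (k * g).entry 1 1 = 1 →
      g ∈ octahedral := fun k hk e0 e1 => by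
    have := SO3.eq_one_of_diag 0 e0 e1
    rw [mul_eq_one_iff_inv_eq] at this
    rw [← this]
    exact inv_mem hk
  have R := axisRot_mem_octahedral 0
  obtain ⟨i, hi⟩ := exists_sq_entry_eq_one hg 1
  rcases sq_eq_one_iff.1 hi with hi | hi <;> fin_cases i <;>
    simp only [Fin.zero_eta, Fin.mk_one, Fin.reduceFinMk] at hi
  · simp [r01] at hi
  · exact key 1 (one_mem _) (by simpa using h) (by simpa using hi)
  · exact key _ (inv_mem R) (by
      simp [SO3.entry_mul, SO3.entry_inv, Fin.sum_univ_three, entry_axisRot, axisRotMatrix, h])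
      (by simp [SO3.entry_mul, SO3.entry_inv, Fin.sum_univ_three, entry_axisRot, axisRotMatrix, hi])
  · simp [r01] at hi
  · exact key _ (mul_mem R R)
      (by simp [mul_assoc, SO3.entry_mul, Fin.sum_univ_three, entry_axisRot, axisRotMatrix, h])
      (by simp [mul_assoc, SO3.entry_mul, Fin.sum_univ_three, entry_axisRot, axisRotMatrix, hi])
  · exact key _ R (by simp [SO3.entry_mul, Fin.sum_univ_three, entry_axisRot, axisRotMatrix, h])
      (by simp [SO3.entry_mul, Fin.sum_univ_three, entry_axisRot, axisRotMatrix, hi])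

/-- Column `0` is one of the six vectors `±eᵢ`; in each case an explicit octahedral rotation takes
it to the first basis vector. -/
theorem integralSO3_le_octahedral : integralSO3 ≤ octahedral := by
  intro g hg
  have key : ∀ k ∈ octahedral, (k * g).entry 0 0 = 1 → g ∈ octahedral := fun k hk e => by
    have := mem_octahedral_of_entry_zero_zero
      (mul_mem (octahedral_le_integralSO3 hk) hg) e
    rwa [Subgroup.mul_mem_cancel_left _ hk] at this
  have R1 := axisRot_mem_octahedral 1
  have R2 := axisRot_mem_octahedral 2
  obtain ⟨i, hi⟩ := exists_sq_entry_eq_one hg 0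
  rcases sq_eq_one_iff.1 hi with hi | hi <;> fin_cases i <;>
    simp only [Fin.zero_eta, Fin.mk_one, Fin.reduceFinMk] at hi
  · exact key 1 (one_mem _) (by simpa using hi)
  · exact key _ (inv_mem R2) (by
      simp [SO3.entry_mul, SO3.entry_inv, Fin.sum_univ_three, entry_axisRot, axisRotMatrix, hi])
  · exact key _ R1 (by simp [SO3.entry_mul, Fin.sum_univ_three, entry_axisRot, axisRotMatrix, hi])
  · exact key _ (mul_mem R2 R2)
      (by simp [mul_assoc, SO3.entry_mul, Fin.sum_univ_three, entry_axisRot, axisRotMatrix, hi])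
  · exact key _ R2 (by simp [SO3.entry_mul, Fin.sum_univ_three, entry_axisRot, axisRotMatrix, hi])
  · exact key _ (inv_mem R1) (by
      simp [SO3.entry_mul, SO3.entry_inv, Fin.sum_univ_three, entry_axisRot, axisRotMatrix, hi])

/-! #### Rotations that preserve an axis are dihedral -/

theorem axisRot_entry_self (a : Fin 3) (θ : ℝ) : (axisRot a θ).entry a a = 1 := by
  fin_cases a <;> simp [SO3.entry, axisRot, axisRotMatrix]

theorem axisRot_entry_cos (a : Fin 3) (θ : ℝ) :
    (axisRot a θ).entry (a + 1) (a + 1) = Real.cos θ := by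
  fin_cases a <;> simp [SO3.entry, axisRot, axisRotMatrix]

theorem axisRot_entry_sin (a : Fin 3) (θ : ℝ) :
    (axisRot a θ).entry (a + 2) (a + 1) = Real.sin θ := by
  fin_cases a <;> simp [SO3.entry, axisRot, axisRotMatrix]

theorem sum_fin_three_shift (a : Fin 3) (f : Fin 3 → ℝ) :
    ∑ i, f i = f a + f (a + 1) + f (a + 2) := by
  fin_cases a <;> simp [Fin.sum_univ_three] <;> ring

/-- A rotation around the axis `a` is determined by its column `a + 1`. -/
theorem eq_axisRot {a : Fin 3} {g : SO3} {θ : ℝ} (h : g.entry a a = 1)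
    (hc : g.entry (a + 1) (a + 1) = Real.cos θ) (hs : g.entry (a + 2) (a + 1) = Real.sin θ) :
    g = axisRot a θ := by
  have hR : ∀ i, i ≠ a → (axisRot a θ).entry i a = 0 := fun i hi =>
    SO3.col_eq_zero (by rw [axisRot_entry_self]; norm_num) hi
  have hg : g.entry a (a + 1) = 0 :=
    SO3.row_eq_zero (by rw [h]; norm_num) (by clear h hc hs hR; decide +revert)
  have h1 : (axisRot a θ)⁻¹ * g = 1 := by
    refine SO3.eq_one_of_diag a ?_ ?_
    · rw [SO3.entry_mul, Finset.sum_eq_single a _ (by simp)]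
      · rw [SO3.entry_inv, axisRot_entry_self, h, one_mul]
      · intro i _ hi
        rw [SO3.entry_inv, hR i hi, zero_mul]
    · rw [SO3.entry_mul, sum_fin_three_shift a, hg, hc, hs]
      simp only [SO3.entry_inv, axisRot_entry_cos, axisRot_entry_sin]
      linarith [Real.cos_sq_add_sin_sq θ]
  exact (inv_mul_eq_one.1 h1).symm

theorem axisRot_add (a : Fin 3) (θ η : ℝ) : axisRot a (θ + η) = axisRot a θ * axisRot a η := by
  refine SO3.ext_entry fun i j => ?_
  rw [SO3.entry_mul, Fin.sum_univ_three]
  fin_cases a <;> fin_cases i <;> fin_cases j <;>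
    simp [entry_axisRot, axisRotMatrix, Real.cos_add, Real.sin_add] <;> ring

theorem axisRot_zero (a : Fin 3) : axisRot a 0 = 1 := by
  have := axisRot_add a 0 0
  rwa [add_zero, left_eq_mul] at this

/-- The angle of a rotation around the axis `a`. -/
def axisAngle (a : Fin 3) (g : SO3) : ℝ :=
  Complex.arg ⟨g.entry (a + 1) (a + 1), g.entry (a + 2) (a + 1)⟩

/-- The column `a + 1` vanishes in row `a`, so its other two entries form a point of the unit
circle, whose argument is the angle. -/
theorem axisRot_axisAngle {a : Fin 3} {g : SO3} (h : g.entry a a = 1) :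
    axisRot a (axisAngle a g) = g := by
  have hg : g.entry a (a + 1) = 0 :=
    SO3.row_eq_zero (by rw [h]; norm_num) (by clear h; decide +revert)
  have hn := g.col_inner (a + 1) (a + 1)
  rw [sum_fin_three_shift a, hg, if_pos rfl] at hn
  have h1 : ‖(⟨g.entry (a + 1) (a + 1), g.entry (a + 2) (a + 1)⟩ : ℂ)‖ = 1 := by
    rw [Complex.norm_def, Complex.normSq_mk, Real.sqrt_eq_one]
    linarith
  have h0 : (⟨g.entry (a + 1) (a + 1), g.entry (a + 2) (a + 1)⟩ : ℂ) ≠ 0 := by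
    rw [← norm_ne_zero_iff, h1]
    exact one_ne_zero
  refine (eq_axisRot h ?_ ?_).symm
  · rw [axisAngle, Complex.cos_arg h0, h1, div_one]
  · rw [axisAngle, Complex.sin_arg, h1, div_one]

/-- A half-turn around an orthogonal axis inverts the rotations around an axis. -/
theorem axisRot_pi_conj (a : Fin 3) (θ : ℝ) :
    axisRot (a + 1) Real.pi * axisRot a θ = axisRot a (-θ) * axisRot (a + 1) Real.pi := by
  refine SO3.ext_entry fun i j => ?_
  rw [SO3.entry_mul, SO3.entry_mul, Fin.sum_univ_three, Fin.sum_univ_three]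
  fin_cases a <;> fin_cases i <;> fin_cases j <;>
    simp [entry_axisRot, axisRotMatrix]

theorem axisRot_pi_entry (a : Fin 3) : (axisRot (a + 1) Real.pi).entry a a = -1 := by
  fin_cases a <;> simp [SO3.entry, axisRot, axisRotMatrix]

/-- A rotation preserving the axis `a` is a rotation around `a`, possibly multiplied by a half-turn
around an orthogonal axis. -/
theorem axisStabilizer_cases {a : Fin 3} {g : SO3} (hg : g ∈ axisStabilizer a) :
    (g.entry a a = 1 ∧ ∃ θ, g = axisRot a θ) ∨
      (g.entry a a = -1 ∧ ∃ θ, g = axisRot a θ * axisRot (a + 1) Real.pi) := by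
  rcases sq_eq_one_iff.1 hg with h | h
  · exact Or.inl ⟨h, _, (axisRot_axisAngle h).symm⟩
  · refine Or.inr ⟨h, axisAngle a (g * (axisRot (a + 1) Real.pi)⁻¹), ?_⟩
    rw [axisRot_axisAngle, inv_mul_cancel_right]
    rw [entry_self_mul hg, SO3.entry_inv, axisRot_pi_entry, h]
    norm_num

theorem axisStabilizer_le_dihedral (a : Fin 3) : axisStabilizer a ≤ dihedral a := by
  intro g hg
  have hR : ∀ θ, axisRot a θ ∈ dihedral a := fun θ =>
    Subgroup.subset_closure (Or.inl ⟨θ, rfl⟩)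
  rcases axisStabilizer_cases hg with ⟨-, θ, rfl⟩ | ⟨-, θ, rfl⟩
  · exact hR θ
  · exact mul_mem (hR θ) (Subgroup.subset_closure (Or.inr rfl))

/-- Conjugation by `g` multiplies the angles of the rotations around a preserved axis by a sign. -/
theorem conj_axisRot {a : Fin 3} {g : SO3} (hg : g ∈ axisStabilizer a) (θ : ℝ) :
    g * axisRot a θ * g⁻¹ = axisRot a (g.entry a a * θ) := by
  rw [mul_inv_eq_iff_eq_mul]
  rcases axisStabilizer_cases hg with ⟨h, η, hη⟩ | ⟨h, η, hη⟩
  · rw [h, hη, one_mul, ← axisRot_add, ← axisRot_add, add_comm]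
  · rw [h, hη, mul_assoc, axisRot_pi_conj, ← mul_assoc, ← mul_assoc, ← axisRot_add, ← axisRot_add,
      neg_one_mul, add_comm]

/-! #### Solvability -/

/-- An extension of a solvable group by an abelian one: `hf` says that the kernel is commutative. -/
theorem isSolvable_of_hom {G H : Type*} [Group G] [Group H] [Group.IsSolvable H] (f : G →* H)
    (hf : ∀ x y, f x = 1 → f y = 1 → x * y = y * x) : Group.IsSolvable G := by
  have : Group.IsSolvable f.ker :=
    Group.isSolvable_of_comm fun x y => Subtype.ext (hf x y x.2 y.2)
  exact Group.isSolvable_of_ker_le_range f.ker.subtype f (by simp)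

/-- The diagonal entry is a sign character whose kernel consists of the rotations around `a`, which
commute. -/
theorem isSolvable_axisStabilizer (a : Fin 3) : Group.IsSolvable (axisStabilizer a) := by
  let χ : axisStabilizer a →* ℝ :=
    { toFun := fun g => g.1.entry a a
      map_one' := by simp [SO3.entry_one]
      map_mul' := fun g h => entry_self_mul g.2 h }
  refine isSolvable_of_hom χ.toHomUnits fun g h hg hh => Subtype.ext ?_
  have hg' : g.1.entry a a = 1 := congrArg Units.val hg
  have hh' : h.1.entry a a = 1 := congrArg Units.val hh
  change g.1 * h.1 = h.1 * g.1
  rw [← axisRot_axisAngle hg', ← axisRot_axisAngle hh', ← axisRot_add, ← axisRot_add, add_comm]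

theorem isSolvable_perm_fin_three : Group.IsSolvable (Equiv.Perm (Fin 3)) :=
  isSolvable_of_hom Equiv.Perm.sign (by decide)

/-- The axis to which an integral rotation sends the axis `j`. -/
def axisImage (g : integralSO3) (j : Fin 3) : Fin 3 :=
  (exists_sq_entry_eq_one g.2 j).choose

theorem axisImage_spec (g : integralSO3) (j : Fin 3) : g.1.entry (axisImage g j) j ^ 2 = 1 :=
  (exists_sq_entry_eq_one g.2 j).choose_spec

theorem axisImage_eq_iff {g : integralSO3} {i j : Fin 3} :
    axisImage g j = i ↔ g.1.entry i j ≠ 0 := by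
  constructor
  · rintro rfl h
    have := axisImage_spec g j
    simp [h] at this
  · intro h
    by_contra hne
    exact h (SO3.col_eq_zero (axisImage_spec g j) (Ne.symm hne))

/-- Integral rotations permute the three axes. -/
@[reducible]
def axisAction : MulAction integralSO3 (Fin 3) where
  smul g j := axisImage g j
  one_smul j := axisImage_eq_iff.2 (by simp [SO3.entry_one])
  mul_smul g h j := axisImage_eq_iff.2 (by
    change (g.1 * h.1).entry (axisImage g (axisImage h j)) j ≠ 0
    rw [SO3.entry_mul, Finset.sum_eq_single (axisImage h j) _ (by simp)]
    · exact mul_ne_zero (axisImage_eq_iff.1 rfl) (axisImage_eq_iff.1 rfl)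
    · intro k _ hk
      rw [SO3.col_eq_zero (axisImage_spec h j) hk, mul_zero])

/-- The kernel of the action on the three axes consists of diagonal matrices, which commute. -/
theorem isSolvable_integralSO3 : Group.IsSolvable integralSO3 := by
  let := axisAction
  have := isSolvable_perm_fin_three
  refine isSolvable_of_hom (MulAction.toPermHom integralSO3 (Fin 3)) fun g h hg hh =>
    Subtype.ext (SO3.ext_entry fun i j => ?_)
  have key : ∀ k : integralSO3, MulAction.toPermHom integralSO3 (Fin 3) k = 1 →
      ∀ i j, i ≠ j → k.1.entry i j = 0 := by
    intro k hk i j hij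
    by_contra h0
    have h1 : axisImage k j = j := congrArg (fun e : Equiv.Perm (Fin 3) => e j) hk
    exact hij ((axisImage_eq_iff.2 h0).symm.trans h1)
  change (g.1 * h.1).entry i j = (h.1 * g.1).entry i j
  rw [SO3.entry_mul, SO3.entry_mul, Finset.sum_eq_single i _ (by simp),
    Finset.sum_eq_single i _ (by simp)]
  · by_cases hij : i = j
    · rw [hij, mul_comm]
    · rw [key g hg i j hij, key h hh i j hij, mul_zero, mul_zero]
  · intro k _ hk
    rw [key h hh i k hk.symm, zero_mul]
  · intro k _ hk
    rw [key g hg i k hk.symm, zero_mul]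

/-- A subgroup of a finite product of groups is solvable if its projections lie in solvable
subgroups of the factors. -/
theorem isSolvable_of_le_pi {P : Type*} [Fintype P] {H : P → Type*} [∀ p, Group (H p)]
    (G : ∀ p, Subgroup (H p)) (hG : ∀ p, Group.IsSolvable (G p)) (A : Subgroup (∀ p, H p))
    (hA : ∀ g ∈ A, ∀ p, g p ∈ G p) : Group.IsSolvable A := by
  choose n hn using fun p => (hG p).solvable
  -- The maximum of the derived lengths of the factors serves for all coordinates at once.
  refine ⟨⟨Finset.univ.sup n, (Subgroup.eq_bot_iff_forall _).2 fun g hg =>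
    Subtype.ext (funext fun p => ?_)⟩⟩
  let f : A →* G p :=
    { toFun := fun g => ⟨g.1 p, hA g.1 g.2 p⟩
      map_one' := rfl
      map_mul' := fun _ _ => rfl }
  have h1 : f g ∈ derivedSeries (G p) (n p) :=
    map_derivedSeries_le_derivedSeries f _
      (Subgroup.mem_map_of_mem f (derivedSeries_antitone A (Finset.le_sup (Finset.mem_univ p)) hg))
  rw [hn p, Subgroup.mem_bot] at h1
  exact congrArg Subtype.val h1

/-! ### Pauli expansion of the code projector -/

theorem trace_tensorOp {P : Type*} [Fintype P] [DecidableEq P] (A : P → Matrix (Fin 2) (Fin 2) ℂ) :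
    (tensorOp A).trace = ∏ p, (A p).trace := by
  simp only [Matrix.trace, Matrix.diag_apply, tensorOp, Matrix.of_apply]
  rw [Fintype.prod_sum (fun p a => A p a a)]

theorem conjTranspose_tensorOp {P : Type*} [Fintype P] (A : P → Matrix (Fin 2) (Fin 2) ℂ) :
    (tensorOp A)ᴴ = tensorOp fun p => (A p)ᴴ := by
  ext i j
  simp [tensorOp]

theorem tensorOp_smul {P : Type*} [Fintype P] (k : P → ℂ) (A : P → Matrix (Fin 2) (Fin 2) ℂ) :
    (tensorOp fun p => k p • A p) = (∏ p, k p) • tensorOp A := by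
  ext i j
  simp [tensorOp, Finset.prod_mul_distrib]

/-- The element of `V` corresponding to an axis: `x`, `z + x`, `z`. -/
def axisVec : Fin 3 → V := ![(0, 1), (1, 1), (1, 0)]

theorem axisVec_ne_zero (i : Fin 3) : axisVec i ≠ 0 := by decide +revert

theorem axisVec_injective : Function.Injective axisVec := by decide

theorem exists_axisVec {v : V} (hv : v ≠ 0) : ∃ i, axisVec i = v := by decide +revert

/-- The Hermitian Pauli operator over `v ∈ V`. -/
def hermPauli (v : V) : Matrix (Fin 2) (Fin 2) ℂ :=
  if v = 0 then 1 else if v = (0, 1) then pauli 0 else if v = (1, 1) then pauli 1 else pauli 2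

theorem hermPauli_zero : hermPauli 0 = 1 := rfl

theorem hermPauli_axisVec (i : Fin 3) : hermPauli (axisVec i) = pauli i := by
  fin_cases i <;> simp [hermPauli, axisVec, Prod.ext_iff]

theorem trace_pauli (i : Fin 3) : (pauli i).trace = 0 := by
  fin_cases i <;> simp [pauli, Matrix.trace_fin_two]

theorem trace_pauli_mul_pauli (i j : Fin 3) :
    (pauli i * pauli j).trace = if i = j then 2 else 0 := by
  fin_cases i <;> fin_cases j <;> simp [pauli, Matrix.trace_fin_two] <;> norm_num

theorem trace_hermPauli (v : V) : (hermPauli v).trace = if v = 0 then 2 else 0 := by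
  split_ifs with h
  · simp [h, hermPauli_zero]
  · obtain ⟨i, rfl⟩ := exists_axisVec h
    rw [hermPauli_axisVec, trace_pauli]

theorem trace_hermPauli_mul (v w : V) :
    (hermPauli v * hermPauli w).trace = if v = w then 2 else 0 := by
  by_cases hv : v = 0
  · rw [hv, hermPauli_zero, one_mul, trace_hermPauli]
    simp only [eq_comm]
  by_cases hw : w = 0
  · rw [hw, hermPauli_zero, mul_one, trace_hermPauli]
  obtain ⟨i, rfl⟩ := exists_axisVec hv
  obtain ⟨j, rfl⟩ := exists_axisVec hw
  rw [hermPauli_axisVec, hermPauli_axisVec, trace_pauli_mul_pauli]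
  simp only [axisVec_injective.eq_iff]

theorem pauliOp_axisVec (i : Fin 3) : ∃ k : ℂ, k ≠ 0 ∧ pauliOp (axisVec i) = k • pauli i := by
  fin_cases i
  · exact ⟨1, one_ne_zero, by simp [pauliOp, axisVec, ZMod.val_one]⟩
  · refine ⟨Complex.I, Complex.I_ne_zero, ?_⟩
    ext a b
    fin_cases a <;> fin_cases b <;> simp [pauliOp, axisVec, pauli, ZMod.val_one]
  · exact ⟨1, one_ne_zero, by simp [pauliOp, axisVec, ZMod.val_one]⟩

theorem exists_pauliOp_eq_smul (v : V) : ∃ k : ℂ, k ≠ 0 ∧ pauliOp v = k • hermPauli v := by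
  by_cases h : v = 0
  · exact ⟨1, one_ne_zero, by simp [h, hermPauli_zero, pauliOp]⟩
  · obtain ⟨i, rfl⟩ := exists_axisVec h
    rw [hermPauli_axisVec]
    exact pauliOp_axisVec i

theorem pauliOp_mul_conjTranspose (v : V) : pauliOp v * (pauliOp v)ᴴ = 1 := by
  have h : ∀ i, pauli i * (pauli i)ᴴ = 1 := by
    intro i
    ext a b
    fin_cases i <;> fin_cases a <;> fin_cases b <;> simp [pauli, Matrix.mul_apply]
  have hp : ∀ i (n : ℕ), pauli i ^ n * (pauli i ^ n)ᴴ = 1 := by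
    intro i n
    induction n with
    | zero => simp
    | succ n ih =>
      rw [pow_succ, Matrix.conjTranspose_mul, mul_assoc, ← mul_assoc (pauli i), h, one_mul, ih]
  rw [pauliOp, Matrix.conjTranspose_mul, mul_assoc, ← mul_assoc (pauli 0 ^ _), hp, one_mul, hp]

/-- Twice the coefficient at `w` in the Pauli expansion of the operator over `v` conjugated
by `u`. -/
def conjCoeff (u : U2) (w v : V) : ℂ :=
  (hermPauli w * ((u : Matrix (Fin 2) (Fin 2) ℂ) * hermPauli v *
    (u : Matrix (Fin 2) (Fin 2) ℂ)ᴴ)).trace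

theorem U2.mul_conjTranspose (u : U2) :
    (u : Matrix (Fin 2) (Fin 2) ℂ) * (u : Matrix (Fin 2) (Fin 2) ℂ)ᴴ = 1 :=
  Matrix.mem_unitaryGroup_iff.1 u.2

theorem U2.conjTranspose_mul (u : U2) :
    (u : Matrix (Fin 2) (Fin 2) ℂ)ᴴ * (u : Matrix (Fin 2) (Fin 2) ℂ) = 1 :=
  Matrix.mem_unitaryGroup_iff'.1 u.2

theorem conjCoeff_zero_left (u : U2) (v : V) : conjCoeff u 0 v = if v = 0 then 2 else 0 := by
  rw [conjCoeff, hermPauli_zero, one_mul, Matrix.trace_mul_comm, ← mul_assoc,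
    U2.conjTranspose_mul, one_mul, trace_hermPauli]

theorem conjCoeff_zero_right (u : U2) (w : V) : conjCoeff u w 0 = if w = 0 then 2 else 0 := by
  rw [conjCoeff, hermPauli_zero, mul_one, U2.mul_conjTranspose, mul_one, trace_hermPauli]

theorem conjCoeff_one (w v : V) : conjCoeff 1 w v = if w = v then 2 else 0 := by
  rw [conjCoeff, ← trace_hermPauli_mul]
  simp

/-- Conjugation preserves the support of Pauli operators. -/
theorem eq_zero_iff_of_conjCoeff_ne_zero {u : U2} {w v : V} (h : conjCoeff u w v ≠ 0) :
    w = 0 ↔ v = 0 := by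
  constructor
  · rintro rfl
    by_contra hv
    exact h (by rw [conjCoeff_zero_left, if_neg hv])
  · rintro rfl
    by_contra hw
    exact h (by rw [conjCoeff_zero_right, if_neg hw])

theorem Represents.conjCoeff_axisVec {u : U2} {g : SO3} (h : Represents u g) (i j : Fin 3) :
    conjCoeff u (axisVec i) (axisVec j) = 2 * g.entry i j := by
  rw [conjCoeff, hermPauli_axisVec, hermPauli_axisVec, h j, Matrix.mul_sum, Matrix.trace_sum]
  simp only [Matrix.mul_smul, Matrix.trace_smul, trace_pauli_mul_pauli, smul_eq_mul, mul_ite,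
    mul_zero]
  rw [Finset.sum_ite_eq, if_pos (Finset.mem_univ i), mul_comm, SO3.entry]

section Projector

variable {P : Type*} [Fintype P] [DecidableEq P] {L : Submodule (ZMod 2) (P → V)}

namespace PauliSection

/-- The operator `σ(v)`. -/
def op (σ : PauliSection L) (v : L) : Op P := σ.toHom (Multiplicative.ofAdd v)

theorem op_add (σ : PauliSection L) (v w : L) : σ.op (v + w) = σ.op v * σ.op w := by
  rw [op, ofAdd_add, map_mul, op, op]

theorem op_zero (σ : PauliSection L) : σ.op 0 = 1 := by
  rw [op, ofAdd_zero, map_one]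

theorem op_mul_self (σ : PauliSection L) (v : L) : σ.op v * σ.op v = 1 := by
  rw [← op_add, ZModModule.add_self, op_zero]

theorem op_mul_conjTranspose (σ : PauliSection L) (v : L) : σ.op v * (σ.op v)ᴴ = 1 := by
  obtain ⟨c, hc, h⟩ := σ.isPauliOver v
  rw [op, h, Matrix.conjTranspose_smul, conjTranspose_tensorOp, Matrix.smul_mul, Matrix.mul_smul,
    tensorOp_mul, smul_smul]
  simp only [pauliOp_mul_conjTranspose, tensorOp_one]
  rw [Complex.star_def, Complex.mul_conj, Complex.normSq_eq_norm_sq, hc]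
  simp

/-- A unitary involution is self-adjoint. -/
theorem isHermitian_op (σ : PauliSection L) (v : L) : (σ.op v)ᴴ = σ.op v := by
  calc (σ.op v)ᴴ = σ.op v * σ.op v * (σ.op v)ᴴ := by rw [op_mul_self, one_mul]
    _ = σ.op v := by rw [mul_assoc, op_mul_conjTranspose, mul_one]

/-- Phases do not matter later: only the non-vanishing of the coefficient is used. -/
theorem exists_op_eq_smul (σ : PauliSection L) (v : L) :
    ∃ c : ℂ, c ≠ 0 ∧ σ.op v = c • tensorOp fun p => hermPauli (v.1 p) := by
  obtain ⟨c, hc, h⟩ := σ.isPauliOver v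
  choose k hk0 hk using fun p => exists_pauliOp_eq_smul (v.1 p)
  refine ⟨c * ∏ p, k p, mul_ne_zero ?_ (Finset.prod_ne_zero_iff.2 fun p _ => hk0 p), ?_⟩
  · rintro rfl
    simp at hc
  · rw [op, h, mul_smul, ← tensorOp_smul]
    simp only [hk]

/-- The sum of all `σ(v)`, a multiple of the orthogonal projector to the code. -/
def sumOp [Fintype L] (σ : PauliSection L) : Op P := ∑ v, σ.op v

variable [Fintype L] (σ : PauliSection L)

theorem op_mul_sumOp (v : L) : σ.op v * σ.sumOp = σ.sumOp := by
  rw [sumOp, Finset.mul_sum]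
  simp only [← op_add]
  exact Fintype.sum_equiv (Equiv.addLeft v) _ _ fun _ => rfl

theorem sumOp_mul_sumOp : σ.sumOp * σ.sumOp = (Fintype.card L : ℂ) • σ.sumOp := by
  nth_rw 1 [sumOp]
  rw [Finset.sum_mul]
  simp only [op_mul_sumOp, Finset.sum_const, Finset.card_univ, Nat.cast_smul_eq_nsmul]

theorem conjTranspose_sumOp : (σ.sumOp)ᴴ = σ.sumOp := by
  simp only [sumOp, Matrix.conjTranspose_sum, isHermitian_op]

theorem sumOp_mulVec_mem (ψ : (P → Fin 2) → ℂ) : σ.sumOp *ᵥ ψ ∈ code σ := by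
  intro v
  change σ.op v *ᵥ _ = _
  rw [Matrix.mulVec_mulVec, op_mul_sumOp]

open scoped ComplexOrder in
/-- A unitary operator that sends the code into itself commutes with the projector. -/
theorem conj_sumOp {U : Op P} (hU : Uᴴ * U = 1) (hc : ∀ ψ ∈ code σ, U *ᵥ ψ ∈ code σ) :
    U * σ.sumOp * Uᴴ = σ.sumOp := by
  set S := σ.sumOp with hS
  set N : ℂ := (Fintype.card L : ℂ) with hN
  -- The columns of `S` lie in the code, and `U` keeps them there, so each `σ(v)` fixes the columns
  -- of `U * S`.
  have h1 : S * (U * S) = N • (U * S) := by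
    have : ∀ v : L, σ.op v * (U * S) = U * S := by
      intro v
      refine Matrix.ext_of_mulVec_single fun i => ?_
      rw [← Matrix.mulVec_mulVec, ← Matrix.mulVec_mulVec]
      exact hc _ (σ.sumOp_mulVec_mem _) v
    nth_rw 1 [hS]
    rw [sumOp, Finset.sum_mul]
    simp only [this, Finset.sum_const, Finset.card_univ, hN, Nat.cast_smul_eq_nsmul]
  set D := U * S * Uᴴ with hD
  have hSS : S * S = N • S := σ.sumOp_mul_sumOp
  have hSD : S * D = N • D := by
    rw [hD, ← mul_assoc, h1, Matrix.smul_mul]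
  have hSh : Sᴴ = S := σ.conjTranspose_sumOp
  have hDh : Dᴴ = D := by
    rw [hD, Matrix.conjTranspose_mul, Matrix.conjTranspose_mul, Matrix.conjTranspose_conjTranspose,
      hSh, mul_assoc]
  have hDS : D * S = N • D := by
    have := congrArg Matrix.conjTranspose hSD
    rw [Matrix.conjTranspose_mul, Matrix.conjTranspose_smul, hDh, hSh] at this
    simpa [hN] using this
  have hDD : D * D = N • D := by
    calc D * D = U * (S * (Uᴴ * U) * S) * Uᴴ := by simp only [hD, mul_assoc]
      _ = N • D := by rw [hU, mul_one, hSS, Matrix.mul_smul, Matrix.smul_mul]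
  have htr : D.trace = S.trace := by
    rw [hD, Matrix.trace_mul_comm, ← mul_assoc, hU, one_mul]
  -- The product equals `N • (S - D)`, and `S` and `D` have the same trace.
  have hz : ((S - D)ᴴ * (S - D)).trace = 0 := by
    rw [Matrix.conjTranspose_sub, hSh, hDh, mul_sub, sub_mul, sub_mul, hSS, hSD, hDS, hDD,
      sub_self, sub_zero, ← smul_sub, Matrix.trace_smul, Matrix.trace_sub, htr, sub_self, smul_zero]
  exact (sub_eq_zero.1 (Matrix.trace_conjTranspose_mul_self_eq_zero_iff.1 hz)).symm

/-- If `u` preserves the code then conjugation of the projector by `b` and by `b u` agree; this is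
the resulting identity of Pauli coefficients. -/
theorem sum_conjCoeff_eq {u : P → U2}
    (hu : ∀ ψ ∈ code σ, tensorOp (fun p => (u p : Matrix (Fin 2) (Fin 2) ℂ)) *ᵥ ψ ∈ code σ)
    {c : L → ℂ} (hc : ∀ v, σ.op v = c v • tensorOp fun p => hermPauli (v.1 p)) (b : P → U2)
    (w : P → V) :
    ∑ v, c v * ∏ p, conjCoeff (b p * u p) (w p) (v.1 p) =
      ∑ v, c v * ∏ p, conjCoeff (b p) (w p) (v.1 p) := by
  have key : ∀ a : P → U2, ∑ v, c v * ∏ p, conjCoeff (a p) (w p) (v.1 p) =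
      (tensorOp (fun p => hermPauli (w p)) *
        (tensorOp (fun p => (a p : Matrix (Fin 2) (Fin 2) ℂ)) * σ.sumOp *
          (tensorOp (fun p => (a p : Matrix (Fin 2) (Fin 2) ℂ)))ᴴ)).trace := by
    intro a
    simp only [sumOp, hc, Matrix.mul_sum, Matrix.sum_mul, Matrix.trace_sum, Matrix.mul_smul,
      Matrix.smul_mul, Matrix.trace_smul, conjTranspose_tensorOp, tensorOp_mul, trace_tensorOp,
      smul_eq_mul, conjCoeff]
  have hU : (tensorOp (fun p => (u p : Matrix (Fin 2) (Fin 2) ℂ)))ᴴ *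
      tensorOp (fun p => (u p : Matrix (Fin 2) (Fin 2) ℂ)) = 1 := by
    simp only [conjTranspose_tensorOp, tensorOp_mul, U2.conjTranspose_mul, tensorOp_one]
  rw [key, key]
  simp only [Submonoid.coe_mul, ← tensorOp_mul, Matrix.conjTranspose_mul]
  nth_rw 2 [← σ.conj_sumOp hU hu]
  simp only [mul_assoc]

end PauliSection

end Projector

/-! ### Minimal supports -/

section Support

variable {P : Type*} {L : Submodule (ZMod 2) (P → V)}

theorem mem_part_iff {S : Set P} {v : P → V} :
    v ∈ part L S ↔ v ∈ L ∧ ∀ q, q ∉ S → v q = 0 := Iff.rfl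

/-- If all of `L` vanished at `p`, the single qubit `p` would be a zero factor. -/
theorem exists_apply_ne_zero (hzero : ¬ HasZeroFactor L) (p : P) : ∃ v ∈ L, v p ≠ 0 := by
  by_contra! h
  refine hzero ⟨{p}, Set.singleton_nonempty p, le_antisymm ?_ ?_, ?_⟩
  · refine le_trans (fun v hv => mem_part_iff.2 ⟨hv, fun q hq => ?_⟩) le_sup_right
    rw [Set.notMem_compl_iff, Set.mem_singleton_iff] at hq
    rw [hq, h v hv]
  · exact sup_le inf_le_left inf_le_left
  · refine (Submodule.eq_bot_iff _).2 fun v hv => funext fun q => ?_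
    by_cases hq : q = p
    · rw [hq, h v hv.1]; rfl
    · exact hv.2 q hq

/-- Among the supports of vectors of `L` that contain `p` there is a minimal one. -/
theorem exists_minimal_support [Fintype P] {p : P} (h : ∃ v ∈ L, v p ≠ 0) :
    ∃ v₀ ∈ L, v₀ p ≠ 0 ∧
      ∀ v ∈ part L {q | v₀ q ≠ 0}, v p ≠ 0 → ∀ q ∈ {q | v₀ q ≠ 0}, v q ≠ 0 := by
  classical
  obtain ⟨v₀, ⟨hv₀, hp⟩, hmin⟩ := exists_minimalFor_of_wellFoundedLT
    (fun v => v ∈ L ∧ v p ≠ 0) (fun v => Finset.univ.filter fun q => v q ≠ 0) h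
  refine ⟨v₀, hv₀, hp, fun v hv hvp q hq => ?_⟩
  have hle : (Finset.univ.filter fun q => v q ≠ 0) ≤ Finset.univ.filter fun q => v₀ q ≠ 0 := by
    intro r hr
    rw [Finset.mem_filter] at hr ⊢
    refine ⟨hr.1, fun h => hr.2 (hv.2 r fun h' => h' h)⟩
  exact (Finset.mem_filter.1 (hmin ⟨hv.1, hvp⟩ hle (Finset.mem_filter.2 ⟨Finset.mem_univ q, hq⟩))).2

theorem V.exhaust {x y : V} (hx : x ≠ 0) (hy : y ≠ 0) (hxy : x ≠ y) (a : V) :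
    a = 0 ∨ a = x ∨ a = y ∨ a = x + y := by
  decide +revert

/-- Two distinct non-zero vectors form a basis of the plane, and the symplectic form is
non-degenerate. -/
theorem V.eq_zero_of_form {x y d : V} (hx : x ≠ 0) (hy : y ≠ 0) (hxy : x ≠ y)
    (h₁ : d.1 * x.2 - d.2 * x.1 = 0) (h₂ : d.1 * y.2 - d.2 * y.1 = 0) : d = 0 := by
  decide +revert

theorem V.form_ne_zero {x y : V} (hx : x ≠ 0) (hy : y ≠ 0) (hxy : x ≠ y) :
    x.1 * y.2 - x.2 * y.1 ≠ 0 := by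
  decide +revert

variable {S : Set P} {p : P} {v₀ v₁ : P → V}

theorem exists_apply_eq (h₀ : v₀ ∈ part L S) (h₁ : v₁ ∈ part L S) (hp₀ : v₀ p ≠ 0)
    (hp₁ : v₁ p ≠ 0) (hp : v₀ p ≠ v₁ p) (a : V) : ∃ v ∈ part L S, v p = a := by
  rcases V.exhaust hp₀ hp₁ hp a with rfl | rfl | rfl | rfl
  · exact ⟨0, zero_mem _, rfl⟩
  · exact ⟨v₀, h₀, rfl⟩
  · exact ⟨v₁, h₁, rfl⟩
  · exact ⟨v₀ + v₁, add_mem h₀ h₁, rfl⟩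

/-- If `L_S` surjects onto `V` at `p` and `S` is a minimal support containing `p` then all non-zero
vectors of `L_S` have support `S`. -/
theorem eq_zero_of_apply_eq_zero
    (hmin : ∀ v ∈ part L S, v p ≠ 0 → ∀ q ∈ S, v q ≠ 0)
    (h₀ : v₀ ∈ part L S) (h₁ : v₁ ∈ part L S) (hp₀ : v₀ p ≠ 0) (hp₁ : v₁ p ≠ 0)
    (hp : v₀ p ≠ v₁ p) {v : P → V} (hv : v ∈ part L S) {q : P} (hq : q ∈ S) (hvq : v q = 0) :
    v = 0 := by
  have hvp : v p = 0 := by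
    by_contra h
    exact hmin v hv h q hq hvq
  funext r
  by_cases hr : r ∈ S
  swap
  · exact hv.2 r hr
  have add_self : ∀ x : V, x + x = 0 := by decide
  have hsum : v₀ p + v₁ p ≠ 0 := by
    revert hp; generalize v₀ p = x; generalize v₁ p = y; decide +revert
  -- If `v` and `x` agreed at `r`, then `x + v` would be non-zero at `p` but vanish at `r`, against
  -- minimality. Applied to `v₀`, `v₁` and their sum, this excludes all three non-zero values of `v
  -- r`.
  have key : ∀ x ∈ part L S, x p ≠ 0 → v r ≠ x r := by
    intro x hx hxp he
    refine hmin (x + v) (add_mem hx hv) ?_ r hr ?_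
    · rwa [Pi.add_apply, hvp, add_zero]
    · rw [Pi.add_apply, he, add_self]
  have hr01 : v₀ r ≠ v₁ r := by
    intro he
    refine hmin (v₀ + v₁) (add_mem h₀ h₁) hsum r hr ?_
    rw [Pi.add_apply, he, add_self]
  rcases V.exhaust (hmin v₀ h₀ hp₀ r hr) (hmin v₁ h₁ hp₁ r hr) hr01 (v r) with h | h | h | h
  · exact h
  · exact absurd h (key v₀ h₀ hp₀)
  · exact absurd h (key v₁ h₁ hp₁)
  · exact absurd h (key (v₀ + v₁) (add_mem h₀ h₁) hsum)

/-- In the situation of `eq_zero_of_apply_eq_zero`, the set `S` has at least three elements if `L`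
has no Bell factor. -/
theorem exists_pair_of_not_hasBellFactor [Fintype P] (hL : IsIsotropic L)
    (hBell : ¬ HasBellFactor L)
    (hmin : ∀ v ∈ part L S, v p ≠ 0 → ∀ q ∈ S, v q ≠ 0)
    (h₀ : v₀ ∈ part L S) (h₁ : v₁ ∈ part L S) (hp₀ : v₀ p ≠ 0) (hp₁ : v₁ p ≠ 0)
    (hp : v₀ p ≠ v₁ p) : ∃ q ∈ S, ∃ r ∈ S, q ≠ p ∧ r ≠ p ∧ q ≠ r := by
  have hpS : p ∈ S := by
    by_contra h
    exact hp₀ (h₀.2 p h)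
  have hzero : ∀ v ∈ part L S, ∀ q ∈ S, v q = 0 → v = 0 := fun v hv q hq =>
    eq_zero_of_apply_eq_zero hmin h₀ h₁ hp₀ hp₁ hp hv hq
  -- With `S = {p}` the form of `v₀` and `v₁` would reduce to its non-zero value at `p`,
  -- contradicting isotropy.
  obtain ⟨q, hqS, hqp⟩ : ∃ q ∈ S, q ≠ p := by
    by_contra! h
    have := hL v₀ h₀.1 v₁ h₁.1
    rw [omega, Finset.sum_eq_single p _ (by simp)] at this
    · exact V.form_ne_zero hp₀ hp₁ hp this
    · intro q _ hq
      simp [h₀.2 q fun hqS => hq (h q hqS)]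
  refine ⟨q, hqS, ?_⟩
  by_contra! h
  have hS : S = {p, q} := by
    ext r
    rw [Set.mem_insert_iff, Set.mem_singleton_iff]
    constructor
    · intro hr
      by_cases hrp : r = p
      · exact Or.inl hrp
      · exact Or.inr (h r hr hqp hrp).symm
    · rintro (rfl | rfl) <;> assumption
  have hcard : S.ncard = 2 := by rw [hS, Set.ncard_pair hqp.symm]
  have hq01 : v₀ q ≠ v₁ q := by
    intro he
    have := hzero (v₀ - v₁) (sub_mem h₀ h₁) q hqS (by rw [Pi.sub_apply, he, sub_self])
    exact hp (by rw [sub_eq_zero.1 this])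
  refine hBell ⟨S, hcard, le_antisymm ?_ (sup_le inf_le_left inf_le_left), ⟨?_, ?_⟩, ?_⟩
  -- Subtract the element `x` of `L_S` with the same value at `p`. The difference is orthogonal to
  -- `L_S` and zero at `p`, so its value at `q` is orthogonal to a basis of the plane and vanishes.
  · intro v hv
    obtain ⟨x, hx, hxp⟩ := exists_apply_eq h₀ h₁ hp₀ hp₁ hp (v p)
    have hd : v - x ∈ L := sub_mem hv hx.1
    have hdp : (v - x) p = 0 := by rw [Pi.sub_apply, hxp, sub_self]
    have form : ∀ y ∈ part L S, ((v - x) q).1 * (y q).2 - ((v - x) q).2 * (y q).1 = 0 := by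
      intro y hy
      have := hL _ hd y hy.1
      rwa [omega, Finset.sum_eq_single q _ (by simp)] at this
      intro r _ hr
      by_cases hrp : r = p
      · rw [hrp, hdp]; simp
      · have : y r = 0 := hy.2 r (by rw [hS]; simp [hr, hrp])
        rw [this]; simp
    have hdq : (v - x) q = 0 :=
      V.eq_zero_of_form (hmin v₀ h₀ hp₀ q hqS) (hmin v₁ h₁ hp₁ q hqS) hq01 (form v₀ h₀) (form v₁ h₁)
    rw [← add_sub_cancel x v]
    refine Submodule.add_mem_sup hx (mem_part_iff.2 ⟨hd, fun r hr => ?_⟩)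
    rw [Set.notMem_compl_iff, hS] at hr
    rcases hr with rfl | rfl
    · exact hdp
    · exact hdq
  · exact fun v hv w hw => hL v hv.1 w hw.1
  · let f : part L S →ₗ[ZMod 2] V := (LinearMap.proj p).comp (part L S).subtype
    have hf : Function.Bijective f := by
      constructor
      · refine (injective_iff_map_eq_zero f).2 fun v hv => Subtype.ext ?_
        exact hzero v.1 v.2 p hpS hv
      · intro a
        obtain ⟨x, hx, hxp⟩ := exists_apply_eq h₀ h₁ hp₀ hp₁ hp a
        exact ⟨⟨x, hx⟩, hxp⟩
    rw [(LinearEquiv.ofBijective f hf).finrank_eq, hcard, Module.finrank_prod, Module.finrank_self]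
  -- Both summands vanish somewhere on `S`, so both are zero, although their sum is `v₀`.
  · intro T hTS hT hne heq
    have hv : v₀ ∈ part L T ⊔ part L (S \ T) := heq ▸ h₀
    obtain ⟨x, hx, y, hy, hxy⟩ := Submodule.mem_sup.1 hv
    obtain ⟨r, hr⟩ := hT
    obtain ⟨s, hsS, hsT⟩ := Set.exists_of_ssubset (hTS.ssubset_of_ne hne)
    have hx0 : x = 0 := hzero x ⟨hx.1, fun t ht => hx.2 t fun h => ht (hTS h)⟩ s hsS (hx.2 s hsT)
    have hy0 : y = 0 := hzero y ⟨hy.1, fun t ht => hy.2 t fun h => ht h.1⟩ r (hTS hr)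
      (hy.2 r fun h => h.2 hr)
    rw [hx0, hy0, add_zero] at hxy
    exact hp₀ (by rw [← hxy]; rfl)

end Support

/-! ### The local constraints on automorphisms -/

section Local

variable {P : Type*} [Fintype P] [DecidableEq P] {L : Submodule (ZMod 2) (P → V)}

/-- Conjugating the code projector with an automorphism `g` at `p` only, or with `g⁻¹` away from
`p`, gives the same operator. So if its Pauli coefficient at `w` has exactly one contribution
on one side then it has some contribution on the other. Here `F q x y` stands for the coefficients
of `g⁻¹` at `q`. -/
theorem exists_coeff_of_mem_autGroup {σ : PauliSection L} {g : P → SO3} (hg : g ∈ autGroup σ)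
    (p : P) : ∃ (F : P → V → V → ℂ),
      (∀ q x y, F q x y ≠ 0 → (x = 0 ↔ y = 0)) ∧
      ∀ (w : P → V) (b : Fin 3), w p = axisVec b → ∀ (x₀ : P → V),
        ((x₀ ∈ L ∧ (∀ q, q ≠ p → x₀ q = w q) ∧
          ∃ a, x₀ p = axisVec a ∧ (g p).entry b a ≠ 0) →
          (∀ x ∈ L, (∀ q, q ≠ p → x q = w q) → x p ≠ 0 → x = x₀) →
          ∃ x ∈ L, x p = w p ∧ ∀ q, q ≠ p → F q (w q) (x q) ≠ 0) ∧
        ((x₀ ∈ L ∧ x₀ p = w p ∧ ∀ q, q ≠ p → F q (w q) (x₀ q) ≠ 0) →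
          (∀ x ∈ L, x p = w p → (∀ q, q ≠ p → F q (w q) (x q) ≠ 0) → x = x₀) →
          ∃ x ∈ L, x p ≠ 0 ∧ ∀ q, q ≠ p → x q = w q) := by
  obtain ⟨u, hu, hcode⟩ := hg
  have : Fintype L := Fintype.ofFinite L
  choose c hc0 hc using σ.exists_op_eq_smul
  refine ⟨fun q x y => conjCoeff (u q)⁻¹ x y, fun q x y h => eq_zero_iff_of_conjCoeff_ne_zero h,
    fun w b hw x₀ => ?_⟩
  -- With `b` the identity at `p` and `u⁻¹` elsewhere, `b u` is `u` at `p` and the identity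
  -- elsewhere. The terms of the two sums are `f` (for `b u`) and `f'` (for `b`).
  have E := σ.sum_conjCoeff_eq hcode hc (fun q => if q = p then 1 else (u q)⁻¹) w
  set f : L → ℂ := fun v => c v * ∏ q,
    conjCoeff ((if q = p then 1 else (u q)⁻¹) * u q) (w q) (v.1 q) with hf
  set f' : L → ℂ := fun v => c v * ∏ q,
    conjCoeff (if q = p then 1 else (u q)⁻¹) (w q) (v.1 q) with hf'
  have hfv : ∀ v, f v ≠ 0 ↔ conjCoeff (u p) (w p) (v.1 p) ≠ 0 ∧ ∀ q, q ≠ p → v.1 q = w q := by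
    intro v
    simp only [hf, mul_ne_zero_iff, Finset.prod_ne_zero_iff, hc0, ne_eq, not_false_eq_true,
      true_and, Finset.mem_univ, true_implies]
    constructor
    · intro h
      refine ⟨by simpa using h p, fun q hq => ?_⟩
      by_contra hne
      have := h q
      rw [if_neg hq, inv_mul_cancel, conjCoeff_one, if_neg (Ne.symm hne)] at this
      exact this rfl
    · rintro ⟨h1, h2⟩ q
      by_cases hq : q = p
      · subst hq; simpa using h1
      · rw [if_neg hq, inv_mul_cancel, conjCoeff_one, h2 q hq, if_pos rfl]
        exact two_ne_zero
  have hfv' : ∀ v, f' v ≠ 0 ↔ v.1 p = w p ∧ ∀ q, q ≠ p → conjCoeff (u q)⁻¹ (w q) (v.1 q) ≠ 0 := by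
    intro v
    simp only [hf', mul_ne_zero_iff, Finset.prod_ne_zero_iff, hc0, ne_eq, not_false_eq_true,
      true_and, Finset.mem_univ, true_implies]
    constructor
    · intro h
      refine ⟨?_, fun q hq => by simpa [hq] using h q⟩
      by_contra hne
      have := h p
      rw [if_pos rfl, conjCoeff_one, if_neg (Ne.symm hne)] at this
      exact this rfl
    · rintro ⟨h1, h2⟩ q
      by_cases hq : q = p
      · subst hq; rw [if_pos rfl, conjCoeff_one, h1, if_pos rfl]; exact two_ne_zero
      · rw [if_neg hq]; exact h2 q hq
  have hwp : w p ≠ 0 := hw ▸ axisVec_ne_zero b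
  have hx0 : ∀ v, f v ≠ 0 → v.1 p ≠ 0 := fun v hv h =>
    hwp ((eq_zero_iff_of_conjCoeff_ne_zero ((hfv v).1 hv).1).2 h)
  constructor
  · rintro ⟨hL, hoff, a, ha, hga⟩ huniq
    have h1 : f ⟨x₀, hL⟩ ≠ 0 := by
      rw [hfv]
      refine ⟨?_, hoff⟩
      change conjCoeff (u p) (w p) (x₀ p) ≠ 0
      rw [hw, ha, (hu p).conjCoeff_axisVec]
      exact mul_ne_zero two_ne_zero (by exact_mod_cast hga)
    have h2 : ∑ v, f v ≠ 0 := by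
      rwa [Finset.sum_eq_single ⟨x₀, hL⟩ _ (by simp)]
      intro v _ hv
      by_contra h
      exact hv (Subtype.ext (huniq v.1 v.2 ((hfv v).1 h).2 (hx0 v h)))
    rw [E] at h2
    obtain ⟨v, -, hv⟩ := Finset.exists_ne_zero_of_sum_ne_zero h2
    exact ⟨v.1, v.2, (hfv' v).1 hv⟩
  · rintro ⟨hL, hF⟩ huniq
    have h1 : f' ⟨x₀, hL⟩ ≠ 0 := (hfv' _).2 hF
    have h2 : ∑ v, f' v ≠ 0 := by
      rwa [Finset.sum_eq_single ⟨x₀, hL⟩ _ (by simp)]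
      intro v _ hv
      by_contra h
      exact hv (Subtype.ext (huniq v.1 v.2 ((hfv' v).1 h).1 ((hfv' v).1 h).2))
    rw [← E] at h2
    obtain ⟨v, -, hv⟩ := Finset.exists_ne_zero_of_sum_ne_zero h2
    exact ⟨v.1, v.2, hx0 v hv, ((hfv v).1 hv).2⟩

/-- At each qubit the automorphisms either all preserve one axis or all permute the axes. -/
theorem autGroup_local (hL : IsIsotropic L) (hzero : ¬ HasZeroFactor L)
    (hBell : ¬ HasBellFactor L) (σ : PauliSection L) (p : P) :
    (∃ a, ∀ g ∈ autGroup σ, g p ∈ axisStabilizer a) ∨ ∀ g ∈ autGroup σ, g p ∈ integralSO3 := by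
  obtain ⟨v₀, hv₀, hp₀, hmin⟩ := exists_minimal_support (exists_apply_ne_zero hzero p)
  set S : Set P := {q | v₀ q ≠ 0} with hS
  have h₀ : v₀ ∈ part L S := ⟨hv₀, fun q hq => not_not.1 hq⟩
  have hnotS : ∀ {q}, q ∉ S ↔ v₀ q = 0 := not_not
  by_cases hcase : ∀ v ∈ part L S, v p ≠ 0 → v p = v₀ p
  · left
    obtain ⟨a, ha⟩ := exists_axisVec hp₀
    -- Suppose the entry at `(b, a)` is non-zero, and replace the value of `v₀` at `p` by `axisVec
    -- b`. At this coefficient `v₀` is the only contribution on the side of `g`; the other side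
    -- yields a vector of `L_S` with value `axisVec b` at `p`, which `hcase` forbids.
    refine ⟨a, fun g hg => mem_axisStabilizer_of_col fun b hb => ?_⟩
    by_contra hne
    obtain ⟨F, hF0, hF⟩ := exists_coeff_of_mem_autGroup hg p
    have hupd : ∀ q, q ≠ p → v₀ q = Function.update v₀ p (axisVec b) q := fun q hq => by
      rw [Function.update_of_ne hq]
    obtain ⟨x, hx, hxp, hxF⟩ := (hF (Function.update v₀ p (axisVec b)) b
      (Function.update_self ..) v₀).1 ⟨hv₀, hupd, a, ha.symm, hne⟩ (by
        intro x hx hoff hxp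
        have hxS : x ∈ part L S := ⟨hx, fun q hq => by
          have hqp : q ≠ p := by rintro rfl; exact hp₀ (hnotS.1 hq)
          rw [hoff q hqp, ← hupd q hqp, hnotS.1 hq]⟩
        funext q
        by_cases hq : q = p
        · rw [hq, hcase x hxS hxp]
        · rw [hoff q hq, ← hupd q hq])
    rw [Function.update_self] at hxp
    have hxS : x ∈ part L S := ⟨hx, fun q hq => by
      have hqp : q ≠ p := by rintro rfl; exact hp₀ (hnotS.1 hq)
      have := hxF q hqp
      rw [← hupd q hqp] at this
      exact (hF0 _ _ _ this).1 (hnotS.1 hq)⟩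
    have := hcase x hxS (hxp ▸ axisVec_ne_zero b)
    rw [hxp, ← ha] at this
    exact hb (axisVec_injective this)
  · right
    push Not at hcase
    obtain ⟨v₁, h₁, hp₁, hne⟩ := hcase
    have hz : ∀ v ∈ part L S, ∀ q ∈ S, v q = 0 → v = 0 := fun v hv q hq =>
      eq_zero_of_apply_eq_zero hmin h₀ h₁ hp₀ hp₁ hne.symm hv hq
    have heq : ∀ x ∈ part L S, ∀ y ∈ part L S, ∀ q ∈ S, x q = y q → x = y := fun x hx y hy q hq h =>
      sub_eq_zero.1 (hz _ (sub_mem hx hy) q hq (by rw [Pi.sub_apply, h, sub_self]))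
    obtain ⟨q, hqS, r, hrS, hqp, hrp, hqr⟩ :=
      exists_pair_of_not_hasBellFactor hL hBell hmin h₀ h₁ hp₀ hp₁ hne.symm
    have hpS : p ∈ S := hp₀
    choose x hxS hxp using fun i => exists_apply_eq h₀ h₁ hp₀ hp₁ hne.symm (axisVec i)
    have hx0 : ∀ i s, s ∈ S → x i s ≠ 0 := fun i s hs h =>
      axisVec_ne_zero i (by rw [← hxp i, hz _ (hxS i) s hs h]; rfl)
    intro g hg
    refine mem_integralSO3_of_row fun b i j hij => ?_
    by_contra hprod
    rw [mul_eq_zero, not_or] at hprod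
    obtain ⟨F, hF0, hF⟩ := exists_coeff_of_mem_autGroup hg p
    have memS : ∀ w : P → V, (∀ s, s ∉ S → w s = 0) → ∀ y ∈ L,
        (∀ s, s ≠ p → F s (w s) (y s) ≠ 0) → y ∈ part L S := by
      intro w hw y hy h
      refine ⟨hy, fun s hs => ?_⟩
      have hsp : s ≠ p := by rintro rfl; exact hs hpS
      exact (hF0 _ _ _ (h s hsp)).1 (hw s hs)
    -- Apply the comparison to `x k` with its value at `p` replaced by that of `x b`. On the other
    -- side only `x b` can contribute, because a vector of `L_S` is determined by its value at `p`.
    have step : ∀ k, (g p).entry b k ≠ 0 → ∀ s, s ≠ p → F s (x k s) (x b s) ≠ 0 := by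
      intro k hk
      have hoff : ∀ s, s ≠ p → Function.update (x k) p (axisVec b) s = x k s := fun s hs =>
        Function.update_of_ne hs ..
      obtain ⟨y, hy, hyp, hyF⟩ := (hF (Function.update (x k) p (axisVec b)) b
        (Function.update_self ..) (x k)).1
        ⟨(hxS k).1, fun s hs => (hoff s hs).symm, k, hxp k, hk⟩ (by
          intro y hy hyo _
          refine heq y ⟨hy, fun s hs => ?_⟩ (x k) (hxS k) q hqS ?_
          · have hsp : s ≠ p := by rintro rfl; exact hs hpS
            rw [hyo s hsp, hoff s hsp, (hxS k).2 s hs]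
          · rw [hyo q hqp, hoff q hqp])
      have hyS := memS _ (fun s hs => by
        have hsp : s ≠ p := by rintro rfl; exact hs hpS
        rw [hoff s hsp, (hxS k).2 s hs]) y hy hyF
      have : y = x b := heq y hyS (x b) (hxS b) p hpS (by rw [hyp, Function.update_self, hxp])
      intro s hs
      have := hyF s hs
      rwa [hoff s hs, ‹y = x b›] at this
    -- This mixes `x i` at `q` with `x j` at the remaining qubits other than `p`. By `step`, `x b`
    -- contributes at `w` on the side of `g⁻¹`, and it does so alone. The resulting `y` on the side
    -- of `g` agrees with `x i` at `q` and with `x j` at `r`, hence equals both; this is where the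
    -- third qubit is needed.
    let w : P → V := fun s => if s = p then axisVec b else if s = q then x i s else x j s
    have hwp : w p = axisVec b := if_pos rfl
    have hwS : ∀ s, s ∉ S → w s = 0 := by
      intro s hs
      have hsp : s ≠ p := by rintro rfl; exact hs hpS
      simp only [w, if_neg hsp]
      split_ifs
      · exact (hxS i).2 s hs
      · exact (hxS j).2 s hs
    obtain ⟨y, hy, hyp, hyo⟩ := (hF w b hwp (x b)).2
      ⟨(hxS b).1, by rw [hwp, hxp], fun s hs => by
        simp only [w, if_neg hs]
        split_ifs
        · exact step i hprod.1 s hs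
        · exact step j hprod.2 s hs⟩ (by
        intro y hy hyp hyF
        exact heq y (memS w hwS y hy hyF) (x b) (hxS b) p hpS (by rw [hyp, hwp, hxp]))
    have hyS : y ∈ part L S := ⟨hy, fun s hs => by
      have hsp : s ≠ p := by rintro rfl; exact hs hpS
      rw [hyo s hsp, hwS s hs]⟩
    have h1 : y = x i := heq y hyS (x i) (hxS i) q hqS (by
      rw [hyo q hqp]; simp only [w, if_neg hqp, if_pos])
    have h2 : y = x j := heq y hyS (x j) (hxS j) r hrS (by
      rw [hyo r hrp]; simp only [w, if_neg hrp, if_neg hqr.symm])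
    exact hij (axisVec_injective (by rw [← hxp i, ← hxp j, ← h1, ← h2]))

end Local

/-! ### Compactness -/

theorem SO3.continuous_entry (i j : Fin 3) : Continuous fun g : SO3 => g.entry i j :=
  (continuous_apply_apply i j).comp continuous_subtype_val

theorem SO3.continuous_of_entry {X : Type*} [TopologicalSpace X] {f : X → SO3}
    (h : ∀ i j, Continuous fun x => (f x).entry i j) : Continuous f :=
  continuous_induced_rng.2 (continuous_matrix h)

instance : IsTopologicalGroup SO3 where
  continuous_mul := SO3.continuous_of_entry fun i j => by
    simp only [SO3.entry_mul]
    exact continuous_finsetSum _ fun k _ => ((SO3.continuous_entry i k).comp continuous_fst).mul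
      ((SO3.continuous_entry k j).comp continuous_snd)
  continuous_inv := SO3.continuous_of_entry fun i j => SO3.continuous_entry j i

theorem isCompact_of_entry_norm_le {n 𝕜 : Type*} [Fintype n] [RCLike 𝕜] {s : Set (Matrix n n 𝕜)}
    (hs : IsClosed s) (h : ∀ A ∈ s, ∀ i j, ‖A i j‖ ≤ 1) : IsCompact s := by
  have hK : IsCompact (Set.univ.pi fun _ : n => Set.univ.pi fun _ : n =>
      Metric.closedBall (0 : 𝕜) 1) :=
    isCompact_univ_pi fun _ => isCompact_univ_pi fun _ => isCompact_closedBall 0 1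
  exact hK.of_isClosed_subset hs fun A hA i _ j _ => by
    simpa using h A hA i j

instance : CompactSpace U2 := by
  refine isCompact_iff_compactSpace.1 (isCompact_of_entry_norm_le isClosed_unitary ?_)
  exact fun A hA => entry_norm_bound_of_unitary hA

instance : CompactSpace SO3 := by
  refine isCompact_iff_compactSpace.1 (isCompact_of_entry_norm_le ?_ ?_)
  · have : (Matrix.specialOrthogonalGroup (Fin 3) ℝ : Set (Matrix (Fin 3) (Fin 3) ℝ)) =
        {A | A * Aᵀ = 1 ∧ A.det = 1} := by
      ext A
      exact Matrix.mem_specialOrthogonalGroup_iff.trans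
        (and_congr_left' (Matrix.mem_orthogonalGroup_iff (Fin 3) ℝ))
    rw [this]
    exact (isClosed_eq (by fun_prop) continuous_const).inter
      (isClosed_eq (by fun_prop) continuous_const)
  · intro A hA i j
    have h := SO3.row_inner ⟨A, hA⟩ i i
    rw [if_pos rfl] at h
    rw [Real.norm_eq_abs, abs_le_one_iff_mul_self_le_one, ← h]
    exact Finset.single_le_sum (f := fun k => A i k * A i k)
      (fun k _ => mul_self_nonneg _) (Finset.mem_univ j)

theorem isClosed_forall_of_isClosed {X : Type*} {ι : Sort*} [TopologicalSpace X] {r : ι → X → Prop}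
    (h : ∀ i, IsClosed {x | r i x}) : IsClosed {x | ∀ i, r i x} := by
  rw [Set.ofPred_forall]
  exact isClosed_iInter h

variable {P : Type*} [Fintype P] [DecidableEq P] {L : Submodule (ZMod 2) (P → V)}

/-- The pairs `(u, g)` satisfying the defining conditions form a closed subset of a compact space,
and the group is its projection. -/
theorem isClosed_autGroup (σ : PauliSection L) : IsClosed (autGroup σ : Set (P → SO3)) := by
  let K : Set ((P → U2) × (P → SO3)) := {x | (∀ p, Represents (x.1 p) (x.2 p)) ∧
    ∀ ψ ∈ code σ, tensorOp (fun p => (x.1 p : Matrix (Fin 2) (Fin 2) ℂ)) *ᵥ ψ ∈ code σ}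
  have hval : ∀ p, Continuous fun x : (P → U2) × (P → SO3) =>
      (x.1 p : Matrix (Fin 2) (Fin 2) ℂ) := fun p =>
    continuous_subtype_val.comp ((continuous_apply p).comp continuous_fst)
  have hK : IsClosed K := by
    refine IsClosed.inter (isClosed_forall_of_isClosed fun p => isClosed_forall_of_isClosed fun j =>
      isClosed_eq ?_ ?_) (isClosed_forall_of_isClosed fun ψ => isClosed_forall_of_isClosed fun _ =>
        (Submodule.closed_of_finiteDimensional (code σ)).preimage ?_)
    · exact ((hval p).mul continuous_const).mul (hval p).matrix_conjTranspose
    · refine continuous_finsetSum _ fun i _ => Continuous.fun_smul ?_ continuous_const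
      exact Complex.continuous_ofReal.comp
        ((SO3.continuous_entry i j).comp ((continuous_apply p).comp continuous_snd))
    · refine Continuous.matrix_mulVec (continuous_matrix fun i j => ?_) continuous_const
      exact continuous_finsetProd _ fun p _ => (hval p).matrix_elem (i p) (j p)
  have himage : (autGroup σ : Set (P → SO3)) = Prod.snd '' K := by
    ext g
    constructor
    · rintro ⟨u, hu, hc⟩
      exact ⟨(u, g), ⟨hu, hc⟩, rfl⟩
    · rintro ⟨⟨u, g⟩, ⟨hu, hc⟩, rfl⟩
      exact ⟨u, hu, hc⟩
  rw [himage]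
  exact (hK.isCompact.image continuous_snd).isClosed

end Stabilizer

/-! ### Lie groups from local one-parameter coordinates -/

/-- A topological group with a continuous homomorphism `exp` from a vector space that is a local
homeomorphism and whose image is normalized linearly. -/
structure LieCoordinates (E G : Type*) [NormedAddCommGroup E] [NormedSpace ℝ E] [Group G]
    [TopologicalSpace G] where
  exp : E → G
  log : G → E
  source : Set G
  target : Set E
  continuous_exp : Continuous exp
  exp_add : ∀ v w, exp (v + w) = exp v * exp w
  isOpen_source : IsOpen source
  isOpen_target : IsOpen target
  one_mem : 1 ∈ source
  zero_mem : 0 ∈ target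
  continuousOn_log : ContinuousOn log source
  exp_log : ∀ g ∈ source, exp (log g) = g
  log_exp : ∀ v ∈ target, log (exp v) = v
  exists_conj : ∀ g : G, ∃ T : E →L[ℝ] E, ∀ v, g⁻¹ * exp v * g = exp (T v)

namespace LieCoordinates

open Topology Filter

variable {E G : Type*} [NormedAddCommGroup E] [NormedSpace ℝ E] [Group G]
    [TopologicalSpace G] (c : LieCoordinates E G)

theorem exp_zero : c.exp 0 = 1 := by
  have := c.exp_add 0 0
  rwa [add_zero, left_eq_mul] at this

theorem exp_neg (v : E) : c.exp (-v) = (c.exp v)⁻¹ := by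
  rw [eq_inv_iff_mul_eq_one, ← c.exp_add, neg_add_cancel, c.exp_zero]

theorem log_one : c.log 1 = 0 := by rw [← c.exp_zero, c.log_exp 0 c.zero_mem]

/-- The chart at the identity. -/
def chartOne : OpenPartialHomeomorph G E where
  toFun := c.log
  invFun := c.exp
  source := c.source ∩ c.log ⁻¹' c.target
  target := c.target ∩ c.exp ⁻¹' c.source
  map_source' := fun g hg => ⟨hg.2, by rw [Set.mem_preimage, c.exp_log g hg.1]; exact hg.1⟩
  map_target' := fun v hv => ⟨hv.2, by rw [Set.mem_preimage, c.log_exp v hv.1]; exact hv.1⟩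
  left_inv' := fun g hg => c.exp_log g hg.1
  right_inv' := fun v hv => c.log_exp v hv.1
  open_source := c.continuousOn_log.isOpen_inter_preimage c.isOpen_source c.isOpen_target
  open_target := c.isOpen_target.inter (c.isOpen_source.preimage c.continuous_exp)
  continuousOn_toFun := c.continuousOn_log.mono Set.inter_subset_left
  continuousOn_invFun := c.continuous_exp.continuousOn

/-- A continuous lift through `exp` of a translate of `exp ∘ Q`, with `Q` smooth, is smooth. -/
theorem contDiffWithinAt_of_exp_eq {X : Type*} [NormedAddCommGroup X] [NormedSpace ℝ X]
    {F Q : X → E} {s : Set X} {x₀ : X} {k : G} (hF : ContinuousWithinAt F s x₀)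
    (hQ : ContDiff ℝ ∞ Q) (h : ∀ᶠ x in 𝓝[s] x₀, c.exp (F x) = k * c.exp (Q x))
    (h₀ : c.exp (F x₀) = k * c.exp (Q x₀)) : ContDiffWithinAt ℝ ∞ F s x₀ := by
  have hk : k = c.exp (F x₀ - Q x₀) := by
    rw [sub_eq_add_neg, c.exp_add, h₀, c.exp_neg, mul_inv_cancel_right]
  -- This difference tends to zero and its exponential is `1`. Injectivity of `exp` near zero makes
  -- it vanish, so `F` is locally `Q` plus a constant.
  have hlim : Tendsto (fun x => F x - (F x₀ - Q x₀ + Q x)) (𝓝[s] x₀) (𝓝 0) := by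
    have h1 := hF.tendsto.sub (tendsto_const_nhds (x := F x₀ - Q x₀) |>.add
      (hQ.continuous.continuousAt.tendsto.mono_left (nhdsWithin_le_nhds (s := s) (a := x₀))))
    simpa using h1
  have hev := hlim (c.isOpen_target.mem_nhds c.zero_mem)
  have hcd : ContDiffWithinAt ℝ ∞ (fun x => F x₀ - Q x₀ + Q x) s x₀ :=
    (contDiff_const.add hQ).contDiffAt.contDiffWithinAt
  refine hcd.congr_of_eventuallyEq ?_ (by simp)
  filter_upwards [h, hev] with x hx hx'
  have h1 : c.exp (F x - (F x₀ - Q x₀ + Q x)) = c.exp 0 := by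
    rw [sub_eq_add_neg, c.exp_add, c.exp_neg, hx, hk, c.exp_add, mul_inv_cancel, c.exp_zero]
  have h2 := congrArg c.log h1
  rw [c.log_exp _ hx', c.log_exp _ c.zero_mem] at h2
  exact sub_eq_zero.1 h2

variable [IsTopologicalGroup G]

/-- The chart at `g`. -/
def chart (g : G) : OpenPartialHomeomorph G E :=
  (Homeomorph.mulLeft g⁻¹).toOpenPartialHomeomorph.trans c.chartOne

theorem chart_apply (g h : G) : c.chart g h = c.log (g⁻¹ * h) := rfl

theorem chart_symm_apply (g : G) (v : E) : (c.chart g).symm v = g * c.exp v := by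
  change g⁻¹⁻¹ * c.exp v = _
  rw [inv_inv]

theorem mem_chart_source {g h : G} :
    h ∈ (c.chart g).source ↔ g⁻¹ * h ∈ c.source ∧ c.log (g⁻¹ * h) ∈ c.target := by
  simp [chart, chartOne]

theorem mul_exp_chart {g h : G} (hh : h ∈ (c.chart g).source) :
    g * c.exp (c.chart g h) = h := by
  rw [chart_apply, c.exp_log _ ((c.mem_chart_source).1 hh).1, mul_inv_cancel_left]

theorem self_mem_chart_source (g : G) : g ∈ (c.chart g).source := by
  rw [mem_chart_source, inv_mul_cancel, c.log_one]
  exact ⟨c.one_mem, c.zero_mem⟩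

/-- The atlas of all translates of the chart at the identity. -/
@[reducible]
def chartedSpace : ChartedSpace E G where
  atlas := Set.range c.chart
  chartAt := c.chart
  mem_chart_source := c.self_mem_chart_source
  chart_mem_atlas g := ⟨g, rfl⟩

/-- A change of charts lifts a left translate of `exp` through `exp`, so it is locally a translation
of the vector space. -/
theorem isManifold {n : ℕ} (c : LieCoordinates (EuclideanSpace ℝ (Fin n)) G) :
    @IsManifold ℝ _ _ _ _ _ _ (𝓡 n) ∞ G _ c.chartedSpace := by
  let := c.chartedSpace
  refine isManifold_of_contDiffOn _ _ _ ?_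
  rintro _ _ ⟨g, rfl⟩ ⟨g', rfl⟩
  simp only [modelWithCornersSelf_coe, modelWithCornersSelf_coe_symm, Function.id_comp,
    Function.comp_id, Set.preimage_id, Set.range_id, Set.inter_univ]
  intro v hv
  have hmem : ∀ w ∈ ((c.chart g).symm ≫ₕ c.chart g').source,
      c.exp (((c.chart g).symm ≫ₕ c.chart g') w) = g'⁻¹ * g * c.exp w := by
    intro w hw
    rw [OpenPartialHomeomorph.trans_source] at hw
    have := c.mul_exp_chart hw.2
    rw [chart_symm_apply] at this
    rw [OpenPartialHomeomorph.coe_trans, Function.comp_apply, chart_symm_apply, mul_assoc,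
      eq_inv_mul_iff_mul_eq, this]
  refine c.contDiffWithinAt_of_exp_eq (Q := id)
    (((c.chart g).symm ≫ₕ c.chart g').continuousOn v hv) contDiff_id
    (eventually_mem_nhdsWithin.mono hmem) (hmem v hv)

/-- In charts centred at the base points, multiplication near `(g, h)` reads `(v, w) ↦ T v + w`,
with `T` describing conjugation by `h`, and inversion near `g` reads `v ↦ T (-v)`, with `T` taken
for `g⁻¹`. -/
theorem lieGroup {n : ℕ} (c : LieCoordinates (EuclideanSpace ℝ (Fin n)) G) :
    @LieGroup ℝ _ _ _ _ _ _ (𝓡 n) ∞ G _ _ c.chartedSpace := by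
  let := c.chartedSpace
  have := c.isManifold
  refine { contMDiff_mul := ?_, contMDiff_inv := ?_ }
  · rintro ⟨g, h⟩
    rw [contMDiffAt_iff]
    refine ⟨continuous_mul.continuousAt, ?_⟩
    obtain ⟨T, hT⟩ := c.exists_conj h
    have hF : ∀ x : EuclideanSpace ℝ (Fin n) × EuclideanSpace ℝ (Fin n),
        (extChartAt (𝓡 n) (g * h) ∘ (fun p : G × G => p.1 * p.2) ∘
          (extChartAt ((𝓡 n).prod (𝓡 n)) (g, h)).symm) x = c.log (c.exp (T x.1 + x.2)) := by
      intro x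
      change c.chart (g * h) ((c.chart g).symm x.1 * (c.chart h).symm x.2) = _
      rw [chart_apply, chart_symm_apply, chart_symm_apply, c.exp_add, ← hT]
      congr 1
      group
    have h0 : extChartAt ((𝓡 n).prod (𝓡 n)) (g, h) (g, h) = 0 := by
      change (c.chart g g, c.chart h h) = 0
      rw [chart_apply, chart_apply, inv_mul_cancel, inv_mul_cancel, c.log_one]
      rfl
    rw [h0]
    have hQ : ContDiff ℝ ∞ fun x : EuclideanSpace ℝ (Fin n) × EuclideanSpace ℝ (Fin n) =>
        T x.1 + x.2 := (T.contDiff.comp contDiff_fst).add contDiff_snd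
    refine (hQ.contDiffAt.congr_of_eventuallyEq ?_).contDiffWithinAt
    have := hQ.continuous.tendsto 0 (c.isOpen_target.mem_nhds (by simpa using c.zero_mem))
    filter_upwards [this] with x hx
    exact (hF x).trans (c.log_exp _ hx)
  · intro g
    rw [contMDiffAt_iff]
    refine ⟨continuous_inv.continuousAt, ?_⟩
    obtain ⟨T, hT⟩ := c.exists_conj g⁻¹
    have hF : ∀ x : EuclideanSpace ℝ (Fin n),
        (extChartAt (𝓡 n) g⁻¹ ∘ (fun p : G => p⁻¹) ∘ (extChartAt (𝓡 n) g).symm) x =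
          c.log (c.exp (T (-x))) := by
      intro x
      change c.chart g⁻¹ ((c.chart g).symm x)⁻¹ = _
      rw [chart_apply, chart_symm_apply, ← hT, c.exp_neg]
      congr 1
      group
    have h0 : extChartAt (𝓡 n) g g = 0 := by
      change c.chart g g = 0
      rw [chart_apply, inv_mul_cancel, c.log_one]
    rw [h0]
    have hQ : ContDiff ℝ ∞ fun x : EuclideanSpace ℝ (Fin n) => T (-x) :=
      T.contDiff.comp contDiff_neg
    refine (hQ.contDiffAt.congr_of_eventuallyEq ?_).contDiffWithinAt
    have := hQ.continuous.tendsto 0 (c.isOpen_target.mem_nhds (by simpa using c.zero_mem))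
    filter_upwards [this] with x hx
    exact (hF x).trans (c.log_exp _ hx)

end LieCoordinates

/-! ### Closed subgroups of Euclidean spaces. -/

namespace AddSubgroup

open Topology Filter

variable {E : Type*} [NormedAddCommGroup E] [InnerProductSpace ℝ E]

/-- The largest linear subspace contained in an additive subgroup of a real vector space. -/
def linearPart (H : AddSubgroup E) : Submodule ℝ E where
  carrier := {w | ∀ t : ℝ, t • w ∈ H}
  add_mem' := fun hv hw t => by rw [smul_add]; exact H.add_mem (hv t) (hw t)
  zero_mem' := fun t => by rw [smul_zero]; exact H.zero_mem
  smul_mem' := fun s w hw t => by rw [smul_smul]; exact hw _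

theorem linearPart_le {H : AddSubgroup E} {w : E} (hw : w ∈ H.linearPart) : w ∈ H := by
  simpa using hw 1

/-- Near zero, a closed subgroup of a Euclidean space agrees with its linear part. -/
theorem exists_mem_linearPart_of_norm_lt [FiniteDimensional ℝ E] (H : AddSubgroup E)
    (hH : IsClosed (H : Set E)) : ∃ r > 0, ∀ h ∈ H, ‖h‖ < r → h ∈ H.linearPart := by
  by_contra! hcon
  set W := H.linearPart with hW
  choose h hH' hlt hnot using fun n : ℕ => hcon (1 / ((n : ℝ) + 1)) Nat.one_div_pos_of_nat
  -- Removing the component in `W` keeps the sequence in `H`, non-zero and convergent to zero, but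
  -- makes it orthogonal to `W`.
  let b : ℕ → E := fun n => h n - W.starProjection (h n)
  have hbW : ∀ n, b n ∈ Wᗮ := fun n => W.sub_starProjection_mem_orthogonal (h n)
  have hbH : ∀ n, b n ∈ H := fun n =>
    H.sub_mem (hH' n) (linearPart_le (W.starProjection_apply_mem (h n)))
  have hb0 : ∀ n, b n ≠ 0 := fun n h0 => hnot n (by
    rw [sub_eq_zero.1 h0]; exact W.starProjection_apply_mem (h n))
  have hh : Tendsto h atTop (𝓝 0) :=
    squeeze_zero_norm (fun n => (hlt n).le) tendsto_one_div_add_atTop_nhds_zero_nat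
  have hb : Tendsto b atTop (𝓝 0) := by
    simpa using hh.sub ((W.starProjection.continuous.tendsto 0).comp hh)
  obtain ⟨u, hu, φ, hφ, hlim⟩ := (isCompact_sphere (0 : E) 1).tendsto_subseq
    (x := fun n => ‖b n‖⁻¹ • b n) fun n => by
      rw [mem_sphere_zero_iff_norm, norm_smul, norm_inv, norm_norm,
        inv_mul_cancel₀ (norm_ne_zero_iff.2 (hb0 n))]
  have huW' : u ∈ Wᗮ := by
    refine (Submodule.isClosed_orthogonal W).mem_of_tendsto hlim (Eventually.of_forall fun n => ?_)
    exact Wᗮ.smul_mem _ (hbW _)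
  -- For each `t`, integral multiples of `b (φ n)` approximate `t • u` with error at most the norm
  -- of `b (φ n)`, and `H` is closed.
  have huW : u ∈ W := by
    intro t
    have h1 : Tendsto (fun n => t • (‖b (φ n)‖⁻¹ • b (φ n)) -
        Int.fract (t * ‖b (φ n)‖⁻¹) • b (φ n)) atTop (𝓝 (t • u - 0)) := by
      refine (hlim.const_smul t).sub ?_
      refine squeeze_zero_norm (fun n => ?_)
        (tendsto_norm_zero.comp (hb.comp hφ.tendsto_atTop))
      rw [norm_smul, Real.norm_of_nonneg (Int.fract_nonneg _)]
      exact mul_le_of_le_one_left (norm_nonneg _) (Int.fract_lt_one _).le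
    rw [sub_zero] at h1
    refine hH.mem_of_tendsto h1 (Eventually.of_forall fun n => ?_)
    rw [smul_smul, ← sub_smul, Int.self_sub_fract, Int.cast_smul_eq_zsmul]
    exact H.zsmul_mem (hbH _) _
  have h0 : u = 0 := by
    have := W.inf_orthogonal_eq_bot
    exact (Submodule.mem_bot ℝ).1 (this ▸ ⟨huW, huW'⟩)
  rw [h0] at hu
  simp at hu

end AddSubgroup

/-! ### Angle coordinates and the Lie group structure of closed subgroups. -/

namespace Stabilizer

theorem continuous_axisRot (a : Fin 3) : Continuous (axisRot a) := by
  refine SO3.continuous_of_entry fun i j => ?_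
  simp only [entry_axisRot]
  fin_cases a <;> fin_cases i <;> fin_cases j <;> simp [axisRotMatrix] <;> fun_prop

theorem axisAngle_axisRot {a : Fin 3} {θ : ℝ} (h₁ : -Real.pi < θ) (h₂ : θ ≤ Real.pi) :
    axisAngle a (axisRot a θ) = θ := by
  rw [axisAngle, axisRot_entry_cos, axisRot_entry_sin]
  have : (⟨Real.cos θ, Real.sin θ⟩ : ℂ) = Complex.cos θ + Complex.sin θ * Complex.I := by
    apply Complex.ext <;> simp [Complex.cos_ofReal_re, Complex.sin_ofReal_re]
  rw [this, Complex.arg_cos_add_sin_mul_I ⟨h₁, h₂⟩]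

theorem continuousAt_axisAngle {a : Fin 3} {g : SO3} (hg : 0 < g.entry (a + 1) (a + 1)) :
    ContinuousAt (axisAngle a) g := by
  -- Positive real part keeps away from the branch cut of `Complex.arg`.
  refine ContinuousAt.comp (g := Complex.arg) (Complex.continuousAt_arg (Or.inl hg)) ?_
  have : Continuous fun g : SO3 => ((g.entry (a + 1) (a + 1) : ℂ) +
      (g.entry (a + 2) (a + 1) : ℂ) * Complex.I) :=
    (Complex.continuous_ofReal.comp (SO3.continuous_entry _ _)).add
      ((Complex.continuous_ofReal.comp (SO3.continuous_entry _ _)).mul continuous_const)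
  simpa only [Complex.mk_eq_add_mul_I] using this.continuousAt

section Torus

variable {P : Type*}

/-- The rotations around the axes `a p` by the angles `w p`. -/
def torusExp (a : P → Fin 3) (w : EuclideanSpace ℝ P) : P → SO3 := fun p => axisRot (a p) (w p)

/-- The angles of the rotations around the axes `a p`. -/
def torusLog (a : P → Fin 3) (g : P → SO3) : EuclideanSpace ℝ P :=
  WithLp.toLp 2 fun p => axisAngle (a p) (g p)

variable (a : P → Fin 3)

theorem torusExp_add (v w : EuclideanSpace ℝ P) :
    torusExp a (v + w) = torusExp a v * torusExp a w :=
  funext fun p => axisRot_add (a p) (v p) (w p)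

theorem torusExp_zero : torusExp a (0 : EuclideanSpace ℝ P) = 1 :=
  funext fun p => axisRot_zero (a p)

theorem torusExp_neg (v : EuclideanSpace ℝ P) : torusExp a (-v) = (torusExp a v)⁻¹ := by
  rw [eq_inv_iff_mul_eq_one, ← torusExp_add, neg_add_cancel, torusExp_zero]

theorem continuous_torusExp : Continuous (torusExp a) :=
  continuous_pi fun p => (continuous_axisRot (a p)).comp (by fun_prop)

/-- The vectors whose exponential lies in a given subgroup. -/
def torusComap (A : Subgroup (P → SO3)) : AddSubgroup (EuclideanSpace ℝ P) where
  carrier := {w | torusExp a w ∈ A}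
  add_mem' := fun {v w} hv hw => by
    change torusExp a (v + w) ∈ A
    rw [torusExp_add]
    exact A.mul_mem hv hw
  zero_mem' := by
    change torusExp a 0 ∈ A
    rw [torusExp_zero]
    exact A.one_mem
  neg_mem' := fun {v} hv => by
    change torusExp a (-v) ∈ A
    rw [torusExp_neg]
    exact A.inv_mem hv

theorem isClosed_torusComap {A : Subgroup (P → SO3)} (hA : IsClosed (A : Set (P → SO3))) :
    IsClosed (torusComap a A : Set (EuclideanSpace ℝ P)) :=
  hA.preimage (continuous_torusExp a)

/-- The families of rotations that preserve the orientation of two coordinate axes up to less than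
a right angle; on it the angles are continuous. -/
def torusNhd : Set (P → SO3) :=
  {g | ∀ p, 0 < (g p).entry (a p) (a p) ∧ 0 < (g p).entry (a p + 1) (a p + 1)}

theorem continuousOn_torusLog : ContinuousOn (torusLog a) (torusNhd a) := by
  intro g hg
  refine ContinuousAt.continuousWithinAt ?_
  refine (PiLp.continuous_toLp 2 _).continuousAt.comp (continuousAt_pi.2 fun p => ?_)
  exact ContinuousAt.comp (g := axisAngle (a p)) (continuousAt_axisAngle (hg p).2)
    (continuous_apply p).continuousAt

variable {a} {A : Subgroup (P → SO3)}

/-- The diagonal entry at `a p` is positive and, in either case, one of `0`, `1`, `-1`. So it is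
`1`, and `g p` is a rotation around that axis. -/
theorem torusExp_torusLog
    (hA : ∀ p, (∀ g ∈ A, g p ∈ axisStabilizer (a p)) ∨ ∀ g ∈ A, g p ∈ integralSO3)
    {g : P → SO3} (hg : g ∈ A) (hN : g ∈ torusNhd a) : torusExp a (torusLog a g) = g := by
  funext p
  refine axisRot_axisAngle ?_
  have h0 := (hN p).1
  rcases hA p with h | h
  · rcases sq_eq_one_iff.1 (h g hg) with h1 | h1
    · exact h1
    · linarith
  · rcases entry_of_mem_integralSO3 (h g hg) (a p) (a p) with h1 | h1 | h1
    · linarith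
    · exact h1
    · linarith

theorem torusLog_torusExp {w : EuclideanSpace ℝ P} (hw : ∀ p, |w p| < Real.pi) :
    torusLog a (torusExp a w) = w := by
  ext p
  exact axisAngle_axisRot (abs_lt.1 (hw p)).1 (abs_lt.1 (hw p)).2.le

theorem isOpen_torusNhd [Finite P] (a : P → Fin 3) : IsOpen (torusNhd a) := by
  rw [torusNhd, Set.ofPred_forall]
  refine isOpen_iInter_of_finite fun p => ?_
  have h : ∀ i j, Continuous fun g : P → SO3 => (g p).entry i j := fun i j =>
    (SO3.continuous_entry i j).comp (continuous_apply p)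
  exact (isOpen_lt continuous_const (h _ _)).inter (isOpen_lt continuous_const (h _ _))

/-- The diagonal action of `g` on the angles. -/
def torusAd (a : P → Fin 3) (g : P → SO3) : EuclideanSpace ℝ P →ₗ[ℝ] EuclideanSpace ℝ P where
  toFun w := WithLp.toLp 2 fun p => (g p).entry (a p) (a p) * w p
  map_add' v w := by ext p; simp [mul_add]
  map_smul' t w := by ext p; simp; ring

variable [Fintype P]

/-- Otherwise a multiple of `w` would give a rotation by `π / 3` at `p`, with the non-integral entry
`1 / 2`. -/
theorem apply_eq_zero_of_mem_linearPart {p : P} (hp : ∀ g ∈ A, g p ∈ integralSO3)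
    {w : EuclideanSpace ℝ P} (hw : w ∈ (torusComap a A).linearPart) : w p = 0 := by
  by_contra h0
  have h1 : torusExp a ((Real.pi / 3 / w p) • w) ∈ A := hw _
  have h2 := entry_of_mem_integralSO3 (hp _ h1) (a p + 1) (a p + 1)
  have h3 : (torusExp a ((Real.pi / 3 / w p) • w) p).entry (a p + 1) (a p + 1) = 1 / 2 := by
    rw [torusExp, axisRot_entry_cos, PiLp.smul_apply, smul_eq_mul, div_mul_cancel₀ _ h0,
      Real.cos_pi_div_three]
  rw [h3] at h2
  norm_num at h2

/-- Where the axis is preserved, conjugation multiplies the angle by a sign; where the rotations are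
integral, the angle is zero. -/
theorem conj_torusExp
    (hA : ∀ p, (∀ g ∈ A, g p ∈ axisStabilizer (a p)) ∨ ∀ g ∈ A, g p ∈ integralSO3)
    {g : P → SO3} (hg : g ∈ A) {w : EuclideanSpace ℝ P} (hw : w ∈ (torusComap a A).linearPart) :
    g⁻¹ * torusExp a w * g = torusExp a (torusAd a g w) := by
  funext p
  change (g p)⁻¹ * axisRot (a p) (w p) * g p = axisRot (a p) ((g p).entry (a p) (a p) * w p)
  rcases hA p with h | h
  · have := conj_axisRot (inv_mem (h g hg)) (w p)
    rwa [inv_inv, SO3.entry_inv] at this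
  · rw [apply_eq_zero_of_mem_linearPart h hw, mul_zero, axisRot_zero, mul_one, inv_mul_cancel]

theorem torusAd_mem_linearPart
    (hA : ∀ p, (∀ g ∈ A, g p ∈ axisStabilizer (a p)) ∨ ∀ g ∈ A, g p ∈ integralSO3)
    {g : P → SO3} (hg : g ∈ A) {w : EuclideanSpace ℝ P} (hw : w ∈ (torusComap a A).linearPart) :
    torusAd a g w ∈ (torusComap a A).linearPart := by
  intro t
  rw [← map_smul]
  change torusExp a _ ∈ A
  rw [← conj_torusExp hA hg (Submodule.smul_mem _ t hw)]
  exact A.mul_mem (A.mul_mem (A.inv_mem hg) (hw t)) hg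

/-- A closed subgroup of a product of octahedral and dihedral groups is a compact Lie group. -/
theorem isCompactLieGroup_of_isClosed (hcl : IsClosed (A : Set (P → SO3)))
    (hA : ∀ p, (∀ g ∈ A, g p ∈ axisStabilizer (a p)) ∨ ∀ g ∈ A, g p ∈ integralSO3) :
    IsCompactLieGroup A := by
  refine ⟨isCompact_iff_compactSpace.1 hcl.isCompact, inferInstance, ?_⟩
  obtain ⟨r, hr, hrW⟩ := (torusComap a A).exists_mem_linearPart_of_norm_lt
    (isClosed_torusComap a hcl)
  set W := (torusComap a A).linearPart with hW
  let e := (stdOrthonormalBasis ℝ W).repr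
  let N : Set (P → SO3) := torusNhd a ∩ torusLog a ⁻¹' Metric.ball 0 r
  have hN : IsOpen N :=
    (continuousOn_torusLog a).isOpen_inter_preimage (isOpen_torusNhd a) Metric.isOpen_ball
  have hlogW : ∀ g ∈ A, g ∈ N → torusLog a g ∈ W := by
    intro g hg hgN
    refine hrW _ ?_ (by simpa using hgN.2)
    change torusExp a (torusLog a g) ∈ A
    rwa [torusExp_torusLog hA hg hgN.1]
  have hval : Continuous fun x => ((e.symm x : W) : EuclideanSpace ℝ P) :=
    continuous_subtype_val.comp e.symm.continuous
  let c : LieCoordinates (EuclideanSpace ℝ (Fin (Module.finrank ℝ W))) A :=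
    { exp := fun x => ⟨torusExp a (e.symm x : W), AddSubgroup.linearPart_le (e.symm x).2⟩
      -- On `source` the angles already lie in `W`; the projection only makes `log` defined
      -- everywhere.
      log := fun g => e (W.orthogonalProjectionOnto (torusLog a g))
      source := Subtype.val ⁻¹' N
      target := {x | ∀ p, |((e.symm x : W) : EuclideanSpace ℝ P) p| < Real.pi}
      continuous_exp := ((continuous_torusExp a).comp hval).subtype_mk _
      exp_add := fun v w => Subtype.ext (by
        rw [map_add]
        exact torusExp_add a _ _)
      isOpen_source := hN.preimage continuous_subtype_val
      isOpen_target := by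
        rw [Set.ofPred_forall]
        refine isOpen_iInter_of_finite fun p => isOpen_lt ?_ continuous_const
        fun_prop
      one_mem := by
        have h1 : torusLog a (1 : P → SO3) = 0 := by
          rw [← torusExp_zero a, torusLog_torusExp]
          intro p
          simpa using Real.pi_pos
        refine ⟨fun p => ?_, ?_⟩
        · simp [SO3.entry_one]
        · rw [Set.mem_preimage]
          change torusLog a 1 ∈ _
          rw [h1]
          exact Metric.mem_ball_self hr
      zero_mem := fun p => by simpa using Real.pi_pos
      continuousOn_log := by
        refine (e.continuous.comp W.orthogonalProjectionOnto.continuous).comp_continuousOn ?_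
        exact (continuousOn_torusLog a).comp continuous_subtype_val.continuousOn fun g hg => hg.1
      exp_log := fun g hg => Subtype.ext (by
        change torusExp a (e.symm (e _) : W) = g.1
        rw [LinearIsometryEquiv.symm_apply_apply,
          Submodule.orthogonalProjectionOnto_mem_subspace_eq_self ⟨_, hlogW g.1 g.2 hg⟩]
        exact torusExp_torusLog hA g.2 hg.1)
      log_exp := fun x hx => by
        change e (W.orthogonalProjectionOnto (torusLog a (torusExp a (e.symm x : W)))) = x
        rw [torusLog_torusExp hx, Submodule.orthogonalProjectionOnto_mem_subspace_eq_self,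
          LinearIsometryEquiv.apply_symm_apply]
      exists_conj := fun g => by
        let T : W →ₗ[ℝ] W := (torusAd a g.1).restrict fun w hw =>
          torusAd_mem_linearPart hA g.2 hw
        refine ⟨LinearMap.toContinuousLinearMap
          (e.toLinearEquiv.toLinearMap ∘ₗ T ∘ₗ e.symm.toLinearEquiv.toLinearMap), fun v =>
            Subtype.ext ?_⟩
        change g.1⁻¹ * torusExp a (e.symm v : W) * g.1 = torusExp a (e.symm (e (T (e.symm v))) : W)
        rw [LinearIsometryEquiv.symm_apply_apply]
        exact conj_torusExp hA g.2 (e.symm v).2 }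
  exact ⟨_, c.chartedSpace, c.lieGroup⟩

end Torus

end Stabilizer

end

theorem mainTheorem3 {P : Type*} [Fintype P] [DecidableEq P]
    (L : Submodule (ZMod 2) (P → V)) (hL : IsIsotropic L)
    (hzero : ¬ HasZeroFactor L) (hBell : ¬ HasBellFactor L) (σ : PauliSection L) :
    Group.IsSolvable (autGroup σ) ∧ IsCompactLieGroup (autGroup σ) ∧
    IsClosed (autGroup σ : Set (P → SO3)) ∧
    ∃ G : P → Subgroup SO3, (∀ p, G p = octahedral ∨ ∃ a, G p = dihedral a) ∧
      autGroup σ ≤ Subgroup.pi Set.univ G := by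
  have hcl := isClosed_autGroup σ
  have hloc : ∀ p, ∃ a, (∀ g ∈ autGroup σ, g p ∈ axisStabilizer a) ∨
      ∀ g ∈ autGroup σ, g p ∈ integralSO3 := fun p => by
    rcases autGroup_local hL hzero hBell σ p with ⟨a, h⟩ | h
    · exact ⟨a, Or.inl h⟩
    -- The axis at an octahedral qubit is arbitrary, since the linear part has no component there.
    · exact ⟨0, Or.inr h⟩
  choose a ha using hloc
  refine ⟨?_, isCompactLieGroup_of_isClosed hcl ha, hcl, ?_⟩
  · have hG : ∀ p, ∃ G : Subgroup SO3, Group.IsSolvable G ∧ ∀ g ∈ autGroup σ, g p ∈ G := fun p => by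
      rcases ha p with h | h
      · exact ⟨_, isSolvable_axisStabilizer (a p), h⟩
      · exact ⟨_, isSolvable_integralSO3, h⟩
    choose G hG hAG using hG
    exact isSolvable_of_le_pi G hG _ fun g hg p => hAG p g hg
  · have hG : ∀ p, ∃ G : Subgroup SO3, (G = octahedral ∨ ∃ a, G = dihedral a) ∧
        ∀ g ∈ autGroup σ, g p ∈ G := fun p => by
      rcases ha p with h | h
      · exact ⟨_, Or.inr ⟨a p, rfl⟩, fun g hg => axisStabilizer_le_dihedral _ (h g hg)⟩
      · exact ⟨_, Or.inl rfl, fun g hg => integralSO3_le_octahedral (h g hg)⟩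
    choose G hG hAG using hG
    exact ⟨G, hG, fun g hg p _ => hAG p g hg⟩
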